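/- Let $\mathbf{C}$ be an adhesive category: it has pullbacks, it has pushouts along monomorphisms, and pushouts along monomorphisms are van Kampen squares. For $a\colon A\to B$ and $c\colon B\to X$, a *final pullback complement* (FPC) of $(c,a)$ is a pair $(d\colon D\to X,\ b\colon A\to D)$ such that $(a,b)$ is a pullback of $(c,d)$ and such that, whenever $(x\colon P\to B,\ y\colon P\to Z)$ is a pullback of $(c,\ z\colon Z\to X)$ and $w\colon P\to A$ satisfies $a\circ w=x$, there is a unique $w^*\colon Z\to D$ with $d\circ w^*=z$ and $w^*\circ y=b\circ w$. Assume that an FPC of $(c,a)$ exists whenever $a,c$ are monomorphisms, and that then $b,d$ are monomorphisms. Assume moreover that $\mathbf{C}$ has a strict initial object $\varnothing$ (every morphism $X\to\varnothing$ is an isomorphism), that $\mathbf{C}$ is finitary (every object has only finitely many subobjects), and that for all objects $Y,X$ there are only finitely many monomorphisms $Y\to X$. A *linear rule* is a span of monomorphisms $p=(O\xleftarrow{o}K\xrightarrow{i}I)$. Two linear rules are isomorphic if there are isomorphisms of their $O$, $K$ and $I$ commuting with the legs. Let $\mathrm{Lin}(\mathbf{C})$ be the collection of isomorphism classes of linear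 rules. An *admissible match* of $p_2$ into $p_1$ is a span of monomorphisms $\mathbf{m}=(I_2\xleftarrow{m_2}M\xrightarrow{m_1}O_1)$ such that, for the pushout $I_2\xrightarrow{n_2}N\xleftarrow{n_1}O_1$ of $\mathbf m$, the pair $K_1\xrightarrow{o_1}O_1\xrightarrow{n_1}N$ has a pushout complement $K_1\xrightarrow{k_1}\overline K_1\xrightarrow{o_1'}N$. Matches are identified when they are isomorphic as spans between $I_2$ and $O_1$. The *composite* $p_2\circ_{\mathbf m}p_1$ is the (class of the) rule $O_{21}\leftarrow K_{21}\to I_{21}$ obtained as follows: - $I_{21}$ is the pushout of $I_1\xleftarrow{i_1}K_1\xrightarrow{k_1}\overline K_1$; - $(i_2'\colon\overline K_2\to N,\ k_2\colon K_2\to \overline K_2)$ is the FPC of $(n_2,i_2)$; - $O_{21}$ is the pushout of $O_2\xleftarrow{o_2}K_2\xrightarrow{k_2}\overline K_2$; - $K_{21}$ is the pullback of $\overline K_2\xrightarrow{i_2'} N\xleftarrow{o_1'}\overline K_1$; - the legs are $K_{21}\to\overline K_2\to O_{21}$ and $K_{21}\to\overline K_1\to I_{21}$. Let $\mathcal R_{\mathbf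 C}$ be the free real vector space with basis $\{\delta(p)\mid p\in \mathrm{Lin}(\mathbf C)\}$, with the bilinear product $\odot$ determined by $$\delta(p_2)\odot\delta(p_1)=\sum_{\mathbf m}\delta(p_2\circ_{\mathbf m}p_1),$$ where $\mathbf m$ runs over all admissible matches of $p_2$ into $p_1$. **Theorem.** For all linear rules $p_2,p_1$ the set of admissible matches of $p_2$ into $p_1$ is finite, and $(\mathcal R_{\mathbf C},\odot)$ is an associative unital $\mathbb R$-algebra with unit element $\delta(\varnothing\leftarrow\varnothing\to\varnothing)$. -/

import Mathlib

open CategoryTheory CategoryTheory.Limits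

universe v u

namespace SqPO

variable {C : Type u} [Category.{v} C]

/-! ### Final pullback complements -/

/-- For `a : A ⟶ B` and `c : B ⟶ X`, the pair `(d, b)` with `b : A ⟶ D`, `d : D ⟶ X` is a
final pullback complement of `(c, a)`. -/
structure IsFPC {A B D X : C} (a : A ⟶ B) (c : B ⟶ X) (b : A ⟶ D) (d : D ⟶ X) : Prop where
  isPullback : IsPullback a b c d
  existsUnique_lift : ∀ {P Z : C} (x : P ⟶ B) (y : P ⟶ Z) (z : Z ⟶ X) (w : P ⟶ A),
    IsPullback x y c z → w ≫ a = x → ∃! t : Z ⟶ D, t ≫ d = z ∧ y ≫ t = w ≫ b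

variable (C) in
/-- All final pullback complements along (composable pairs of) monomorphisms exist, and
monomorphisms are stable under final pullback complements. -/
class HasMonoFPCs : Prop where
  exists_isFPC : ∀ {A B X : C} (a : A ⟶ B) (c : B ⟶ X) [Mono a] [Mono c],
    ∃ (D : C) (b : A ⟶ D) (d : D ⟶ X), IsFPC a c b d
  mono_of_isFPC : ∀ {A B D X : C} {a : A ⟶ B} {c : B ⟶ X} {b : A ⟶ D} {d : D ⟶ X}
    [Mono a] [Mono c], IsFPC a c b d → Mono b ∧ Mono d

/-! ### Linear rules -/

theorem inv_comm {W X W' X' : C} {f : W ⟶ X} {f' : W' ⟶ X'} {eW : W ≅ W'} {eX : X ≅ X'}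
    (h : f ≫ eX.hom = eW.hom ≫ f') : f' ≫ eX.inv = eW.inv ≫ f := by
  rw [Iso.comp_inv_eq, Category.assoc, h, Iso.inv_hom_id_assoc]

variable (C) in
/-- A linear rule: a span of monomorphisms `O ⟵ K ⟶ I` with output `O` and input `I`. -/
structure Rule where
  O : C
  K : C
  I : C
  o : K ⟶ O
  i : K ⟶ I
  [mono_o : Mono o]
  [mono_i : Mono i]

attribute [instance] Rule.mono_o Rule.mono_i

/-- An isomorphism of linear rules. -/
structure RuleIso (p q : Rule C) where
  eO : p.O ≅ q.O
  eK : p.K ≅ q.K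
  eI : p.I ≅ q.I
  comm_o : p.o ≫ eO.hom = eK.hom ≫ q.o
  comm_i : p.i ≫ eI.hom = eK.hom ≫ q.i

def RuleIso.refl (p : Rule C) : RuleIso p p :=
  ⟨Iso.refl _, Iso.refl _, Iso.refl _, by simp, by simp⟩

def RuleIso.symm {p q : Rule C} (e : RuleIso p q) : RuleIso q p :=
  ⟨e.eO.symm, e.eK.symm, e.eI.symm,
    inv_comm e.comm_o,
    inv_comm e.comm_i⟩

def RuleIso.trans {p q r : Rule C} (e : RuleIso p q) (f : RuleIso q r) : RuleIso p r :=
  ⟨e.eO ≪≫ f.eO, e.eK ≪≫ f.eK, e.eI ≪≫ f.eI,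
    by simp [reassoc_of% e.comm_o, f.comm_o], by simp [reassoc_of% e.comm_i, f.comm_i]⟩

variable (C) in
instance ruleSetoid : Setoid (Rule C) where
  r p q := Nonempty (RuleIso p q)
  iseqv := ⟨fun p => ⟨RuleIso.refl p⟩, fun ⟨e⟩ => ⟨e.symm⟩, fun ⟨e⟩ ⟨f⟩ => ⟨e.trans f⟩⟩

variable (C) in
/-- Isomorphism classes of linear rules. -/
abbrev Lin : Type (max u v) := Quotient (ruleSetoid C)

/-- The rule `∅ ⟵ ∅ ⟶ ∅`. -/
noncomputable def emptyRule (C : Type u) [Category.{v} C] [HasInitial C] : Rule C where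
  O := ⊥_ C
  K := ⊥_ C
  I := ⊥_ C
  o := 𝟙 _
  i := 𝟙 _

/-! ### Admissible matches -/

/-- An admissible match of `p₂` into `p₁`: a span of monomorphisms `I₂ ⟵ M ⟶ O₁` such that, with
`I₂ ⟶ N ⟵ O₁` the pushout of the span, `K₁ ⟶ O₁ ⟶ N` has a pushout complement. -/
structure Match (p₂ p₁ : Rule C) where
  M : C
  m₂ : M ⟶ p₂.I
  m₁ : M ⟶ p₁.O
  [mono_m₂ : Mono m₂]
  [mono_m₁ : Mono m₁]
  admissible : ∃ (N : C) (n₂ : p₂.I ⟶ N) (n₁ : p₁.O ⟶ N)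
    (L : C) (k : p₁.K ⟶ L) (l : L ⟶ N),
    IsPushout m₂ m₁ n₂ n₁ ∧ IsPushout p₁.o k n₁ l

attribute [instance] Match.mono_m₂ Match.mono_m₁

/-- Matches are identified when they are isomorphic as spans between `I₂` and `O₁`. -/
instance matchSetoid (p₂ p₁ : Rule C) : Setoid (Match p₂ p₁) where
  r m m' := ∃ e : m.M ≅ m'.M, e.hom ≫ m'.m₂ = m.m₂ ∧ e.hom ≫ m'.m₁ = m.m₁
  iseqv := ⟨fun m => ⟨Iso.refl _, by simp, by simp⟩,
    fun ⟨e, h₂, h₁⟩ => ⟨e.symm, by simp [← h₂], by simp [← h₁]⟩,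
    fun ⟨e, h₂, h₁⟩ ⟨f, k₂, k₁⟩ => ⟨e ≪≫ f, by simp [k₂, h₂], by simp [k₁, h₁]⟩⟩

/-- The set of admissible matches of `p₂` into `p₁`. -/
abbrev MatchClass (p₂ p₁ : Rule C) : Type (max u v) := Quotient (matchSetoid p₂ p₁)

/-! ### Composition of rules -/

/-- The diagram that computes the composite of `p₂` with `p₁` along a match `m`. -/
structure CompDiagram {p₂ p₁ : Rule C} (m : Match p₂ p₁) where
  (N K₂' K₁' O₂₁ I₂₁ K₂₁ : C)
  n₂ : p₂.I ⟶ N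
  n₁ : p₁.O ⟶ N
  k₂ : p₂.K ⟶ K₂'
  i₂' : K₂' ⟶ N
  n₂s : p₂.O ⟶ O₂₁
  o₂' : K₂' ⟶ O₂₁
  k₁ : p₁.K ⟶ K₁'
  o₁' : K₁' ⟶ N
  n₁s : p₁.I ⟶ I₂₁
  i₁' : K₁' ⟶ I₂₁
  i₂'' : K₂₁ ⟶ K₂'
  o₁'' : K₂₁ ⟶ K₁'
  po : IsPushout m.m₂ m.m₁ n₂ n₁
  poc : IsPushout p₁.o k₁ n₁ o₁'
  poI : IsPushout p₁.i k₁ n₁s i₁'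
  fpc : IsFPC p₂.i n₂ k₂ i₂'
  poO : IsPushout p₂.o k₂ n₂s o₂'
  pb : IsPullback i₂'' o₁'' i₂' o₁'

theorem isPushout_iso {W X Y P W' X' Y' P' : C} {f : W ⟶ X} {g : W ⟶ Y} {h : X ⟶ P} {i : Y ⟶ P}
    {f' : W' ⟶ X'} {g' : W' ⟶ Y'} {h' : X' ⟶ P'} {i' : Y' ⟶ P'}
    (H : IsPushout f g h i) (H' : IsPushout f' g' h' i')
    (eW : W ≅ W') (eX : X ≅ X') (eY : Y ≅ Y')
    (hf : f ≫ eX.hom = eW.hom ≫ f') (hg : g ≫ eY.hom = eW.hom ≫ g') :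
    ∃ eP : P ≅ P', h ≫ eP.hom = eX.hom ≫ h' ∧ i ≫ eP.hom = eY.hom ≫ i' := by
  have H'' : IsPushout f g (eX.hom ≫ h') (eY.hom ≫ i') :=
    H'.of_iso eW.symm eX.symm eY.symm (Iso.refl _)
      (inv_comm hf) (inv_comm hg)
      (by simp) (by simp)
  exact ⟨H.isoIsPushout _ _ H'', by simp, by simp⟩

theorem isPullback_iso {P X Y Z P' X' Y' Z' : C} {f : P ⟶ X} {g : P ⟶ Y} {h : X ⟶ Z} {i : Y ⟶ Z}
    {f' : P' ⟶ X'} {g' : P' ⟶ Y'} {h' : X' ⟶ Z'} {i' : Y' ⟶ Z'}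
    (H : IsPullback f g h i) (H' : IsPullback f' g' h' i')
    (eX : X ≅ X') (eY : Y ≅ Y') (eZ : Z ≅ Z')
    (hh : h ≫ eZ.hom = eX.hom ≫ h') (hi : i ≫ eZ.hom = eY.hom ≫ i') :
    ∃ eP : P ≅ P', f ≫ eX.hom = eP.hom ≫ f' ∧ g ≫ eY.hom = eP.hom ≫ g' := by
  have H'' : IsPullback (f ≫ eX.hom) (g ≫ eY.hom) h' i' :=
    H.of_iso (Iso.refl _) eX eY eZ (by simp) (by simp) hh hi
  exact ⟨H''.isoIsPullback _ _ H', by simp, by simp⟩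

theorem IsFPC.exists_hom {A B D X A' B' D' X' : C}
    {a : A ⟶ B} {c : B ⟶ X} {b : A ⟶ D} {d : D ⟶ X}
    {a' : A' ⟶ B'} {c' : B' ⟶ X'} {b' : A' ⟶ D'} {d' : D' ⟶ X'}
    (H : IsPullback a b c d) (H' : IsFPC a' c' b' d')
    (eA : A ≅ A') (eB : B ≅ B') (eX : X ≅ X')
    (ha : a ≫ eB.hom = eA.hom ≫ a') (hc : c ≫ eX.hom = eB.hom ≫ c') :
    ∃ t : D ⟶ D', t ≫ d' = d ≫ eX.hom ∧ b ≫ t = eA.hom ≫ b' := by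
  have H'' : IsPullback (a ≫ eB.hom) b c' (d ≫ eX.hom) :=
    H.of_iso (Iso.refl _) eB (Iso.refl _) eX (by simp) (by simp) hc (by simp)
  exact (H'.existsUnique_lift _ _ _ eA.hom H'' ha.symm).exists

theorem IsFPC.iso {A B D X A' B' D' X' : C}
    {a : A ⟶ B} {c : B ⟶ X} {b : A ⟶ D} {d : D ⟶ X}
    {a' : A' ⟶ B'} {c' : B' ⟶ X'} {b' : A' ⟶ D'} {d' : D' ⟶ X'}
    (H : IsFPC a c b d) (H' : IsFPC a' c' b' d') [Mono d] [Mono d']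
    (eA : A ≅ A') (eB : B ≅ B') (eX : X ≅ X')
    (ha : a ≫ eB.hom = eA.hom ≫ a') (hc : c ≫ eX.hom = eB.hom ≫ c') :
    ∃ eD : D ≅ D', b ≫ eD.hom = eA.hom ≫ b' ∧ d ≫ eX.hom = eD.hom ≫ d' := by
  obtain ⟨t, ht, ht'⟩ := IsFPC.exists_hom H.isPullback H' eA eB eX ha hc
  obtain ⟨s, hs, -⟩ := IsFPC.exists_hom H'.isPullback H eA.symm eB.symm eX.symm
    (inv_comm ha)
    (inv_comm hc)
  refine ⟨⟨t, s, ?_, ?_⟩, ht', ht.symm⟩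
  · rw [← cancel_mono d, Category.assoc, hs, reassoc_of% ht]; simp
  · rw [← cancel_mono d', Category.assoc, ht, reassoc_of% hs]; simp

section

variable [Adhesive C]

/-- In an adhesive category, pushouts along monomorphisms are final pullback complements. -/
theorem IsFPC.of_isPushout {A B D X : C} {a : A ⟶ B} {c : B ⟶ X} {b : A ⟶ D} {d : D ⟶ X}
    [Mono a] [Mono c] (h : IsPushout a b c d) : IsFPC a c b d := by
  have : Mono d := Adhesive.mono_of_isPushout_of_mono_left h
  refine ⟨Adhesive.isPullback_of_isPushout_of_mono_left h, ?_⟩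
  intro P Z x y z w hp hw
  have hd : IsPullback (pullback.fst d z) (pullback.snd d z) d z := IsPullback.of_hasPullback d z
  have hx : HasPullback x a := hasPullback_symmetry a x
  obtain ⟨W, f', g', α, hf, -, hpo⟩ :=
    (Adhesive.van_kampen h).exists_cube_filling hp.flip hd.flip
  have : Mono f' := ⟨fun s t hst => by
    refine hf.hom_ext hst ?_
    rw [← cancel_mono a, Category.assoc, Category.assoc, ← hf.w, reassoc_of% hst]⟩
  have hs : hf.lift (𝟙 P) w (by simp [hw]) ≫ f' = 𝟙 P := hf.lift_fst _ _ _
  have : IsSplitEpi f' := ⟨⟨⟨_, hs⟩⟩⟩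
  have : IsIso f' := isIso_of_mono_of_isSplitEpi f'
  have : IsIso (pullback.snd d z) := hpo.isIso_inr_of_isIso
  have hz : (inv (pullback.snd d z) ≫ pullback.fst d z) ≫ d = z := by
    simp [pullback.condition]
  refine ⟨inv (pullback.snd d z) ≫ pullback.fst d z, ⟨hz, ?_⟩, ?_⟩
  · rw [← cancel_mono d, Category.assoc, hz, Category.assoc, ← h.w, reassoc_of% hw, hp.w]
  · rintro t ⟨ht, -⟩
    rw [← cancel_mono d, hz, ht]

variable [HasMonoFPCs C]

theorem Match.nonempty_compDiagram {p₂ p₁ : Rule C} (m : Match p₂ p₁) :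
    Nonempty (CompDiagram m) := by
  obtain ⟨N, n₂, n₁, K₁', k₁, o₁', po, poc⟩ := m.admissible
  have : Mono n₁ := Adhesive.mono_of_isPushout_of_mono_left po
  have : Mono n₂ := Adhesive.mono_of_isPushout_of_mono_right po
  have : Mono o₁' := Adhesive.mono_of_isPushout_of_mono_left poc
  obtain ⟨K₂', k₂, i₂', fpc⟩ := HasMonoFPCs.exists_isFPC p₂.i n₂
  have : HasPullback i₂' o₁' := hasPullback_symmetry o₁' i₂'
  exact ⟨⟨_, _, _, _, _, _, _, _, _, _, _, _, _, _, _, _, _, _, po, poc,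
    IsPushout.of_hasPushout p₁.i k₁, fpc, IsPushout.of_hasPushout p₂.o k₂,
    IsPullback.of_hasPullback i₂' o₁'⟩⟩

namespace CompDiagram

variable {p₂ p₁ : Rule C} {m : Match p₂ p₁} (D : CompDiagram m)

instance mono_n₁ : Mono D.n₁ := Adhesive.mono_of_isPushout_of_mono_left D.po

instance mono_n₂ : Mono D.n₂ := Adhesive.mono_of_isPushout_of_mono_right D.po

instance mono_o₁' : Mono D.o₁' := Adhesive.mono_of_isPushout_of_mono_left D.poc

instance mono_i₂' : Mono D.i₂' := (HasMonoFPCs.mono_of_isFPC D.fpc).2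

instance mono_o₂' : Mono D.o₂' := Adhesive.mono_of_isPushout_of_mono_left D.poO

instance mono_i₁' : Mono D.i₁' := Adhesive.mono_of_isPushout_of_mono_left D.poI

instance mono_i₂'' : Mono D.i₂'' := ⟨fun _ _ h => D.pb.hom_ext h (by
  rw [← cancel_mono D.o₁', Category.assoc, Category.assoc, ← D.pb.w, reassoc_of% h])⟩

instance mono_o₁'' : Mono D.o₁'' := ⟨fun _ _ h => D.pb.hom_ext (by
  rw [← cancel_mono D.i₂', Category.assoc, Category.assoc, D.pb.w, reassoc_of% h]) h⟩

/-- The composite rule `O₂₁ ⟵ K₂₁ ⟶ I₂₁`. -/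
def comp : Rule C where
  O := D.O₂₁
  K := D.K₂₁
  I := D.I₂₁
  o := D.i₂'' ≫ D.o₂'
  i := D.o₁'' ≫ D.i₁'

theorem nonempty_ruleIso {q₂ q₁ : Rule C} {m' : Match q₂ q₁} (D' : CompDiagram m')
    (f₂ : RuleIso p₂ q₂) (f₁ : RuleIso p₁ q₁) (e : m.M ≅ m'.M)
    (h₂ : m.m₂ ≫ f₂.eI.hom = e.hom ≫ m'.m₂) (h₁ : m.m₁ ≫ f₁.eO.hom = e.hom ≫ m'.m₁) :
    Nonempty (RuleIso D.comp D'.comp) := by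
  obtain ⟨eN, hn₂, hn₁⟩ := isPushout_iso D.po D'.po e f₂.eI f₁.eO h₂ h₁
  obtain ⟨eK₂, hk₂, hi₂⟩ := D.fpc.iso D'.fpc f₂.eK f₂.eI eN f₂.comm_i hn₂
  obtain ⟨eK₁, hk₁, ho₁⟩ := (IsFPC.of_isPushout D.poc).iso (IsFPC.of_isPushout D'.poc)
    f₁.eK f₁.eO eN f₁.comm_o hn₁
  obtain ⟨eO, -, hO⟩ := isPushout_iso D.poO D'.poO f₂.eK f₂.eO eK₂ f₂.comm_o hk₂
  obtain ⟨eI, -, hI⟩ := isPushout_iso D.poI D'.poI f₁.eK f₁.eI eK₁ f₁.comm_i hk₁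
  obtain ⟨eK, hK₂, hK₁⟩ := isPullback_iso D.pb D'.pb eK₂ eK₁ eN hi₂ ho₁
  exact ⟨⟨eO, eK, eI, by simp [comp, hO, reassoc_of% hK₂], by simp [comp, hI, reassoc_of% hK₁]⟩⟩

end CompDiagram

/-- The isomorphism class of the composite of `p₂` with `p₁` along a match. -/
noncomputable def compClass {p₂ p₁ : Rule C} : MatchClass p₂ p₁ → Lin C :=
  Quotient.lift (fun m => ⟦m.nonempty_compDiagram.some.comp⟧) fun _ _ ⟨e, h₂, h₁⟩ =>
    Quotient.sound (CompDiagram.nonempty_ruleIso _ _ (RuleIso.refl _) (RuleIso.refl _) e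
      (by simp [RuleIso.refl, h₂]) (by simp [RuleIso.refl, h₁]))

end

/-! ### Dependence of matches on the rules -/

/-- The transport of a match along isomorphisms of rules. -/
def Match.transport {p₂ p₁ q₂ q₁ : Rule C} (f₂ : RuleIso p₂ q₂) (f₁ : RuleIso p₁ q₁)
    (m : Match p₂ p₁) : Match q₂ q₁ where
  M := m.M
  m₂ := m.m₂ ≫ f₂.eI.hom
  m₁ := m.m₁ ≫ f₁.eO.hom
  admissible := by
    obtain ⟨N, n₂, n₁, L, k, l, h, h'⟩ := m.admissible
    refine ⟨N, f₂.eI.inv ≫ n₂, f₁.eO.inv ≫ n₁, L, f₁.eK.inv ≫ k, l, ?_, ?_⟩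
    · exact h.of_iso (Iso.refl _) f₂.eI f₁.eO (Iso.refl _) (by simp) (by simp) (by simp) (by simp)
    · exact h'.of_iso f₁.eK f₁.eO (Iso.refl _) (Iso.refl _) f₁.comm_o (by simp) (by simp) (by simp)

/-- Isomorphic rules have the same isomorphism classes of matches. -/
def matchEquiv {p₂ p₁ q₂ q₁ : Rule C} (f₂ : RuleIso p₂ q₂) (f₁ : RuleIso p₁ q₁) :
    MatchClass p₂ p₁ ≃ MatchClass q₂ q₁ where
  toFun := Quotient.map (Match.transport f₂ f₁) fun _ _ ⟨e, h₂, h₁⟩ =>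
    ⟨e, by simp [Match.transport, reassoc_of% h₂], by simp [Match.transport, reassoc_of% h₁]⟩
  invFun := Quotient.map (Match.transport f₂.symm f₁.symm) fun _ _ ⟨e, h₂, h₁⟩ =>
    ⟨e, by simp [Match.transport, reassoc_of% h₂], by simp [Match.transport, reassoc_of% h₁]⟩
  left_inv := by
    rintro ⟨m⟩
    exact Quotient.sound ⟨Iso.refl _, by simp [Match.transport, RuleIso.symm],
      by simp [Match.transport, RuleIso.symm]⟩
  right_inv := by
    rintro ⟨m⟩
    exact Quotient.sound ⟨Iso.refl _, by simp [Match.transport, RuleIso.symm],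
      by simp [Match.transport, RuleIso.symm]⟩

/-! ### The rule algebra -/

variable (C) in
/-- The free real vector space on isomorphism classes of linear rules. -/
abbrev RuleAlgebra : Type (max u v) := Lin C →₀ ℝ

/-- The basis vector of the rule algebra given by an isomorphism class of linear rules. -/
noncomputable def δ (p : Lin C) : RuleAlgebra C := Finsupp.single p 1

variable [Adhesive C] [HasMonoFPCs C]

theorem compClass_matchEquiv {p₂ p₁ q₂ q₁ : Rule C} (f₂ : RuleIso p₂ q₂) (f₁ : RuleIso p₁ q₁)
    (m : MatchClass p₂ p₁) : compClass (matchEquiv f₂ f₁ m) = compClass m := by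
  obtain ⟨m⟩ := m
  exact (Quotient.sound (CompDiagram.nonempty_ruleIso _ _ f₂ f₁ (Iso.refl _)
    (by simp [Match.transport]) (by simp [Match.transport]))).symm

/-- The product of two basis vectors: the sum over all isomorphism classes of admissible
matches of the composite along the match. -/
noncomputable def basisMul : Lin C → Lin C → RuleAlgebra C :=
  Quotient.lift₂ (fun p₂ p₁ => ∑ᶠ m : MatchClass p₂ p₁, δ (compClass m))
    fun _ _ _ _ ⟨f₂⟩ ⟨f₁⟩ => finsum_eq_of_bijective (matchEquiv f₂ f₁) (matchEquiv f₂ f₁).bijective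
      fun m => by rw [compClass_matchEquiv]

variable (C) in
/-- The product of the rule algebra: the bilinear extension of the product of basis vectors. -/
noncomputable def mul : RuleAlgebra C →ₗ[ℝ] RuleAlgebra C →ₗ[ℝ] RuleAlgebra C :=
  Finsupp.linearCombination ℝ fun p₂ => Finsupp.linearCombination ℝ fun p₁ => basisMul p₂ p₁

end SqPO

/-!
On subobjects, a final pullback complement behaves like a Heyting implication: `z` factors through
`d` if and only if every part of `z` that lies in `B` already lies in `A`. A pushout of
monomorphisms is a union, and van Kampen squares make it a cover which detects whether a morphism
factors through a monomorphism. So squares of monomorphisms are recognised by comparing the sieves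
that the monomorphisms generate.

A pair of matches for `p₃ (p₂ p₁)`, and equally one for `(p₃ p₂) p₁`, glues the three rules to a
*triple composition*: a derivation `Y ⟵ L ⟶ X` by `p₂` with an occurrence of the output of `p₁` in
`X` and of the input of `p₃` in `Y`, in which `L` is no larger than these occurrences require.
From a triple composition the pair of matches is read off as intersections of subobjects, and two
triple compositions come from the same pair exactly when one embeds into the other. Since this holds
for both bracketings and the composite rule depends only on the triple composition, the two kinds of
pairs correspond bijectively.

For the unit, a monomorphism into `∅` is an isomorphism, so the empty rule has exactly one match
into, and from, every rule.
-/

/-! ### Covers by monomorphisms and final pullback complements -/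

namespace SqPO

open Sieve (generateSingleton)

section Covers

variable {C : Type u} [Category.{v} C]

theorem generateSingleton_le_iff {A X : C} {a : A ⟶ X} {S : Sieve X} :
    generateSingleton a ≤ S ↔ S a :=
  ⟨fun h => h _ ⟨𝟙 A, Category.id_comp a⟩, fun h _ _ ⟨t, ht⟩ => ht ▸ S.downward_closed h t⟩

theorem generateSingleton_eq_pullback {A B D X : C} {a : A ⟶ B} {b : A ⟶ D} {c : B ⟶ X}
    {d : D ⟶ X} (h : IsPullback a b c d) :
    generateSingleton a = (generateSingleton d).pullback c := by
  refine le_antisymm (generateSingleton_le_iff.2 ⟨b, h.w.symm⟩) fun _ x ⟨y, hy⟩ => ?_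
  exact ⟨h.lift x y hy.symm, h.lift_fst _ _ _⟩

theorem isPullback_of_generateSingleton {A B D X : C} {a : A ⟶ B} {b : A ⟶ D} {c : B ⟶ X}
    {d : D ⟶ X} [Mono a] [Mono d] (w : a ≫ c = b ≫ d)
    (h : (generateSingleton d).pullback c ≤ generateSingleton a) : IsPullback a b c d := by
  have lift : ∀ s : PullbackCone c d, ∃ t, t ≫ a = s.fst :=
    fun s => h s.fst ⟨s.snd, s.condition.symm⟩
  choose t ht using lift
  refine ⟨⟨w⟩, ⟨PullbackCone.IsLimit.mk _ t ht (fun s => ?_) fun s r hr _ => ?_⟩⟩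
  · rw [← cancel_mono d, Category.assoc, ← w, reassoc_of% ht s, s.condition]
  · rw [← cancel_mono a, hr, ht]

theorem isPullback_comp_mono {A B D X Y : C} {a : A ⟶ B} {b : A ⟶ D} {c : B ⟶ X} {d : D ⟶ X}
    (h : IsPullback a b c d) (u : X ⟶ Y) [Mono u] : IsPullback a b (c ≫ u) (d ≫ u) :=
  ⟨⟨by rw [reassoc_of% h.w]⟩, ⟨PullbackCone.isLimitOfCompMono c d u _ h.isLimit⟩⟩

theorem isPullback_of_fac {B D X : C} {n : B ⟶ D} {u : D ⟶ X} {c : B ⟶ X} [Mono u] [Mono c]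
    (hn : n ≫ u = c) : IsPullback n (𝟙 B) u c :=
  have : Mono n := mono_of_mono_fac hn
  isPullback_of_generateSingleton (by rw [hn, Category.id_comp]) fun _ x ⟨t, ht⟩ =>
    ⟨t, by rw [← cancel_mono u, Category.assoc, hn, ht]⟩

theorem exists_isPullback_of_isPullback {P A B U P' A' B' U' : C}
    {p : P ⟶ A} {q : P ⟶ B} {a : A ⟶ U} {b : B ⟶ U}
    {p' : P' ⟶ A'} {q' : P' ⟶ B'} {a' : A' ⟶ U'} {b' : B' ⟶ U'}
    {α : A ⟶ A'} {β : B ⟶ B'} {u : U ⟶ U'}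
    (hP : IsPullback p q a b) (hP' : IsPullback p' q' a' b')
    (hA : IsPullback a α u a') (hB : IsPullback b β u b') :
    ∃ k : P ⟶ P', IsPullback p k α p' ∧ IsPullback q k β q' := by
  have hA' := hP.paste_vert hB
  have hB' := hP.flip.paste_vert hA
  rw [hA.w] at hA'
  rw [hB.w] at hB'
  refine ⟨hP'.lift (p ≫ α) (q ≫ β) (by rw [Category.assoc, ← hA'.w]),
    IsPullback.of_bot ?_ (hP'.lift_fst _ _ _).symm hP',
    IsPullback.of_bot ?_ (hP'.lift_snd _ _ _).symm hP'.flip⟩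
  · rwa [hP'.lift_snd]
  · rwa [hP'.lift_fst]

/-- The Grothendieck topology in which a sieve covers `X` if, over every `z : Z ⟶ X`, it detects
whether a morphism out of `Z` factors through a given monomorphism. It is the largest topology for
which all monomorphisms generate closed sieves. -/
def monoTopology (C : Type u) [Category.{v} C] : GrothendieckTopology C where
  sieves X := {S | ∀ ⦃Z : C⦄ (z : Z ⟶ X) ⦃Y W : C⦄ (s : Y ⟶ W) [Mono s] (q : Z ⟶ W),
    S.pullback z ≤ (generateSingleton s).pullback q → generateSingleton s q}
  top_mem' X Z z Y W s _ q h := by simpa using h (𝟙 Z) trivial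
  pullback_stable' X Y S g hS Z z Y' W s _ q h := by
    refine hS (z ≫ g) s q ?_
    rwa [Sieve.pullback_comp]
  transitive' X S hS R hR Z z Y W s _ q h := by
    refine hS z s q fun V f hf => hR hf (𝟙 V) s (f ≫ q) ?_
    rw [Sieve.pullback_id, Sieve.pullback_comp, Sieve.pullback_comp]
    exact Sieve.pullback_monotone f h

theorem isClosed_generateSingleton {Y W : C} (s : Y ⟶ W) [Mono s] :
    (monoTopology C).IsClosed (generateSingleton s) :=
  fun _ q hq => hq (𝟙 _) s q (by rw [Sieve.pullback_id])

theorem sup_mem_monoTopology_of_isPullback {B D X B' D' M : C} {c : B ⟶ X} {d : D ⟶ X} {m : M ⟶ X}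
    {c' : B' ⟶ M} {β : B' ⟶ B} {d' : D' ⟶ M} {γ : D' ⟶ D} (hc : IsPullback c' β m c)
    (hd : IsPullback d' γ m d)
    (h : generateSingleton c ⊔ generateSingleton d ∈ monoTopology C X) :
    generateSingleton c' ⊔ generateSingleton d' ∈ monoTopology C M := by
  rw [generateSingleton_eq_pullback hc, generateSingleton_eq_pullback hd]
  exact (monoTopology C).superset_covering (fun _ _ hf => hf)
    ((monoTopology C).pullback_stable m h)

theorem mem_monoTopology_of_sup_mem {D X : C} {R S : Sieve X} {d : D ⟶ X}
    (h : R ⊔ generateSingleton d ∈ monoTopology C X) (hR : R ≤ S)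
    (hd : S.pullback d ∈ monoTopology C D) : S ∈ monoTopology C X := by
  refine (monoTopology C).transitive h S ?_
  rintro Z z (hz | ⟨t, rfl⟩)
  · rw [S.pullback_eq_top_of_mem (hR _ hz)]
    exact (monoTopology C).top_mem Z
  · rw [Sieve.pullback_comp]
    exact (monoTopology C).pullback_stable t hd

end Covers

section FinalPullbackComplements

variable {C : Type u} [Category.{v} C]

theorem isFPC_of_generateSingleton {A B D X : C} {a : A ⟶ B} {c : B ⟶ X} {b : A ⟶ D} {d : D ⟶ X}
    [Mono d] (hp : IsPullback a b c d)
    (H : ∀ ⦃Z : C⦄ (z : Z ⟶ X),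
      (∀ ⦃V : C⦄ (f : V ⟶ Z) (x : V ⟶ B), x ≫ c = f ≫ z → generateSingleton a x) →
        generateSingleton d z) :
    IsFPC a c b d := by
  refine ⟨hp, fun {P Z} x y z w h hw => ?_⟩
  obtain ⟨t, ht⟩ := H z fun V f x' hx' =>
    ⟨h.lift x' f hx' ≫ w, by rw [Category.assoc, hw, h.lift_fst]⟩
  refine ⟨t, ⟨ht, ?_⟩, fun r hr => ?_⟩
  · rw [← cancel_mono d, Category.assoc, ht, Category.assoc, ← hp.w, reassoc_of% hw, h.w]
  · rw [← cancel_mono d, ht, hr.1]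

variable [Adhesive C]

theorem IsFPC.generateSingleton_iff {A B D X Z : C} {a : A ⟶ B} {c : B ⟶ X} {b : A ⟶ D} {d : D ⟶ X}
    [Mono c] (h : IsFPC a c b d) {z : Z ⟶ X} :
    generateSingleton d z ↔
      ∀ ⦃V : C⦄ (f : V ⟶ Z) (x : V ⟶ B), x ≫ c = f ≫ z → generateSingleton a x := by
  refine ⟨fun ⟨t, ht⟩ V f x hx => ?_, fun H => ?_⟩
  · exact ⟨h.isPullback.lift x (f ≫ t) (by rw [hx, Category.assoc, ht]),
      h.isPullback.lift_fst _ _ _⟩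
  · have hp := IsPullback.of_hasPullback c z
    obtain ⟨w, hw⟩ := H _ _ hp.w
    obtain ⟨t, ⟨ht, -⟩, -⟩ := h.existsUnique_lift _ _ _ w hp hw
    exact ⟨t, ht⟩

theorem IsFPC.paste_horiz {A B D X D' X' : C} {a : A ⟶ B} {c : B ⟶ X} {b : A ⟶ D}
    {d : D ⟶ X} {c' : X ⟶ X'} {b' : D ⟶ D'} {d' : D' ⟶ X'} [Mono c] [Mono c'] [Mono d']
    (H : IsFPC a c b d) (H' : IsFPC d c' b' d') : IsFPC a (c ≫ c') (b ≫ b') d' := by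
  refine isFPC_of_generateSingleton
    (H.isPullback.flip.paste_horiz H'.isPullback.flip).flip fun Z z hz => ?_
  refine H'.generateSingleton_iff.2 fun V f x hx => H.generateSingleton_iff.2 fun V' f' x' hx' => ?_
  exact hz (f' ≫ f) x' (by rw [reassoc_of% hx', hx, Category.assoc])

theorem IsFPC.paste_vert {A B D X A' D' : C} {a : A ⟶ B} {c : B ⟶ X} {b : A ⟶ D} {d : D ⟶ X}
    {a' : A' ⟶ A} {b' : A' ⟶ D'} {d' : D' ⟶ D} [Mono a] [Mono b] [Mono c] [Mono d] [Mono d']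
    (H : IsFPC a c b d) (H' : IsFPC a' b b' d') : IsFPC (a' ≫ a) c b' (d' ≫ d) := by
  refine isFPC_of_generateSingleton (H'.isPullback.paste_horiz H.isPullback) fun Z z hz => ?_
  obtain ⟨y, rfl⟩ := H.generateSingleton_iff.2 fun V f x hx => by
    obtain ⟨t, ht⟩ := hz f x hx
    exact ⟨t ≫ a', by rw [Category.assoc, ht]⟩
  obtain ⟨t, rfl⟩ := H'.generateSingleton_iff.2 fun V f x hx => by
    obtain ⟨t, ht⟩ := hz f (x ≫ a) (by
      rw [Category.assoc, H.isPullback.w, reassoc_of% hx])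
    exact ⟨t, by rw [← cancel_mono a, Category.assoc, ht]⟩
  exact ⟨t, (Category.assoc _ _ _).symm⟩

theorem IsFPC.of_comp {A B D X D' X' : C} {a : A ⟶ B} {c : B ⟶ X} {b : A ⟶ D} {d : D ⟶ X}
    {u : X ⟶ X'} {b' : A ⟶ D'} {d' : D' ⟶ X'} {t : D ⟶ D'} [Mono c] [Mono u] [Mono d] [Mono d']
    (H : IsFPC a c b d) (H' : IsFPC a (c ≫ u) b' d') (w : d ≫ u = t ≫ d') : IsFPC d u t d' := by
  have hp : IsPullback d t u d' := isPullback_of_generateSingleton w fun Z x hx =>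
    H.generateSingleton_iff.2 fun V f y hy =>
      H'.generateSingleton_iff.1 hx f y (by rw [reassoc_of% hy])
  refine isFPC_of_generateSingleton hp fun Z z hz => H'.generateSingleton_iff.2 fun V f x hx => ?_
  rw [generateSingleton_eq_pullback H.isPullback]
  exact hz f (x ≫ c) (by rw [Category.assoc, hx])

theorem IsFPC.exists_of_comp {A B D X D' X' : C} {a : A ⟶ B} {c : B ⟶ X} {b : A ⟶ D} {d : D ⟶ X}
    {u : X ⟶ X'} {b' : A ⟶ D'} {d' : D' ⟶ X'} [Mono c] [Mono u] [Mono d] [Mono d']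
    (H : IsFPC a c b d) (H' : IsFPC a (c ≫ u) b' d') : ∃ t, b ≫ t = b' ∧ IsFPC d u t d' := by
  obtain ⟨t, ⟨ht, hb⟩, -⟩ := H'.existsUnique_lift a b (d ≫ u) (𝟙 A)
    (isPullback_comp_mono H.isPullback u) (Category.id_comp a)
  exact ⟨t, by rw [hb, Category.id_comp], H.of_comp H' ht.symm⟩

theorem IsFPC.of_isPullback {A B D X A' B' D' M : C} {a : A ⟶ B} {c : B ⟶ X} {b : A ⟶ D}
    {d : D ⟶ X} {a' : A' ⟶ B'} {c' : B' ⟶ M} {b' : A' ⟶ D'} {d' : D' ⟶ M} {α : A' ⟶ A}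
    {β : B' ⟶ B} {γ : D' ⟶ D} {m : M ⟶ X} [Mono a] [Mono c] [Mono d] (H : IsFPC a c b d)
    (ha : IsPullback a' α β a) (hc : IsPullback c' β m c) (hd : IsPullback d' γ m d)
    (w : a' ≫ c' = b' ≫ d') : IsFPC a' c' b' d' := by
  have : Mono a' := ha.mono_fst_of_mono
  have : Mono d' := hd.mono_fst_of_mono
  refine isFPC_of_generateSingleton (isPullback_of_generateSingleton w ?_) fun Z z hz => ?_
  · rw [generateSingleton_eq_pullback hd, ← Sieve.pullback_comp, hc.w, Sieve.pullback_comp,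
      ← generateSingleton_eq_pullback H.isPullback, generateSingleton_eq_pullback ha]
  · rw [generateSingleton_eq_pullback hd]
    refine H.generateSingleton_iff.2 fun V f x hx => ?_
    have hx' : x ≫ c = (f ≫ z) ≫ m := by rw [hx, Category.assoc]
    have h := hz f (hc.lift (f ≫ z) x hx'.symm) (hc.lift_fst _ _ _)
    rw [generateSingleton_eq_pullback ha] at h
    simpa using h

end FinalPullbackComplements

section Adhesive

variable {C : Type u} [Category.{v} C] [Adhesive C]

theorem exists_mono_desc {A B D X Y : C} {a : A ⟶ B} {b : A ⟶ D} {c : B ⟶ X} {d : D ⟶ X}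
    {c' : B ⟶ Y} {d' : D ⟶ Y} [Mono c'] [Mono d'] (h : IsPushout a b c d)
    (h' : IsPullback a b c' d') : ∃ u : X ⟶ Y, Mono u ∧ c ≫ u = c' ∧ d ≫ u = d' := by
  have hU : IsPushout a b (pushout.inl (pullback.fst c' d') (pullback.snd c' d'))
      (pushout.inr (pullback.fst c' d') (pullback.snd c' d')) :=
    (IsPushout.of_hasPushout _ _).of_iso h'.isoPullback.symm (Iso.refl _) (Iso.refl _)
      (Iso.refl _) (by simp) (by simp) (by simp) (by simp)
  exact ⟨(h.isoIsPushout _ _ hU).hom ≫ pushout.desc c' d' pullback.condition,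
    inferInstance, by simp [pushout.inl_desc], by simp [pushout.inr_desc]⟩

theorem isPushout_of_isPullback {A B D X : C} {a : A ⟶ B} {b : A ⟶ D} {c : B ⟶ X} {d : D ⟶ X}
    [Mono c] [Mono d] (h : IsPullback a b c d)
    (H : generateSingleton c ⊔ generateSingleton d ∈ monoTopology C X) : IsPushout a b c d := by
  have : Mono a := h.mono_fst_of_mono
  have hU := IsPushout.of_hasPushout a b
  obtain ⟨u, _, hc, hd⟩ := exists_mono_desc hU h
  have hu : generateSingleton c ⊔ generateSingleton d ≤ generateSingleton u :=
    sup_le (generateSingleton_le_iff.2 ⟨_, hc⟩) (generateSingleton_le_iff.2 ⟨_, hd⟩)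
  obtain ⟨t, ht⟩ := isClosed_generateSingleton u (𝟙 X)
    (by simpa [GrothendieckTopology.Covers] using (monoTopology C).superset_covering hu H)
  have : IsSplitEpi u := ⟨⟨⟨t, ht⟩⟩⟩
  have : IsIso u := isIso_of_mono_of_isSplitEpi u
  exact hU.of_iso (Iso.refl _) (Iso.refl _) (Iso.refl _) (asIso u) (by simp) (by simp)
    (by simpa using hc) (by simpa using hd)

theorem sup_mem_monoTopology_of_isPushout {A B D X : C} {a : A ⟶ B} {b : A ⟶ D} {c : B ⟶ X}
    {d : D ⟶ X} [Mono a] [Mono c] (h : IsPushout a b c d) :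
    generateSingleton c ⊔ generateSingleton d ∈ monoTopology C X := by
  intro Z z Y W s _ q H
  have : Mono d := Adhesive.mono_of_isPushout_of_mono_left h
  have hc := (IsPullback.of_hasPullback c z).flip
  have hd := (IsPullback.of_hasPullback d z).flip
  have := hasPullback_symmetry a (pullback.fst c z)
  obtain ⟨W', f', g', -, -, -, hpo⟩ := (Adhesive.van_kampen h).exists_cube_filling hc hd
  obtain ⟨t₁, h₁⟩ := H (pullback.snd c z) (Or.inl ⟨_, hc.w.symm⟩)
  obtain ⟨t₂, h₂⟩ := H (pullback.snd d z) (Or.inr ⟨_, hd.w.symm⟩)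
  have ht : f' ≫ t₁ = g' ≫ t₂ := by
    rw [← cancel_mono s, Category.assoc, h₁, Category.assoc, h₂, reassoc_of% hpo.w]
  exact ⟨hpo.desc t₁ t₂ ht, hpo.hom_ext (by rw [hpo.inl_desc_assoc, h₁])
    (by rw [hpo.inr_desc_assoc, h₂])⟩

theorem exists_isPushout_of_comp_mono {A B D X N : C} {a : A ⟶ B} {b : A ⟶ D} {n : B ⟶ N}
    {u : N ⟶ X} {d : D ⟶ X} [Mono a] [Mono n] [Mono u] (h : IsPushout a b (n ≫ u) d) :
    ∃ (D' : C) (b' : A ⟶ D') (d' : D' ⟶ N), IsPushout a b' n d' := by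
  have : Mono d := Adhesive.mono_of_isPushout_of_mono_left h
  have hd := IsPullback.of_hasPullback u d
  have hb := (IsPullback.of_right'
    (Adhesive.isPullback_of_isPushout_of_mono_left h).flip hd.flip).flip
  exact ⟨_, _, _, isPushout_of_isPullback hb (sup_mem_monoTopology_of_isPullback
    (isPullback_of_fac rfl) hd (sup_mem_monoTopology_of_isPushout h))⟩

theorem exists_isPushout_of_isPushout_comp {A B D X B' : C} {a : A ⟶ B} {b : B ⟶ B'}
    {k : A ⟶ D} {v : B' ⟶ X} {l : D ⟶ X} [Mono a] (h : IsPushout (a ≫ b) k v l) :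
    ∃ (L : C) (w : B ⟶ L) (r : D ⟶ L) (l' : L ⟶ X),
      IsPushout a k w r ∧ IsPushout b w v l' ∧ r ≫ l' = l := by
  have hL := IsPushout.of_hasPushout a k
  obtain ⟨l', hv, hl⟩ := hL.exists_desc (b ≫ v) l (by rw [← h.w, Category.assoc])
  subst hl
  exact ⟨_, _, _, l', hL, IsPushout.of_left h hv.symm hL, rfl⟩

end Adhesive

/-! ### Derivations -/

/-- A sesqui-pushout derivation from `X` to `Y` by the rule `p`: a final pullback complement of the
occurrence `mI` of the input of `p` in `X`, followed by a pushout. As in `Rule`, the span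
`Y ⟵ L ⟶ X` is read from right to left. -/
structure Derivation {C : Type u} [Category.{v} C] (p : Rule C) where
  (X L Y : C)
  mI : p.I ⟶ X
  mK : p.K ⟶ L
  mO : p.O ⟶ Y
  o : L ⟶ Y
  i : L ⟶ X
  [mono_mI : Mono mI]
  fpc : IsFPC p.i mI mK i
  po : IsPushout p.o mK mO o

/-- An embedding of derivations by the same rule, over a monomorphism between the objects they
start from. -/
structure Derivation.Hom {C : Type u} [Category.{v} C] {p : Rule C} (S S' : Derivation p) where
  homX : S.X ⟶ S'.X
  homL : S.L ⟶ S'.L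
  homY : S.Y ⟶ S'.Y
  [mono_homX : Mono homX]
  mI_homX : S.mI ≫ homX = S'.mI
  i_homX : S.i ≫ homX = homL ≫ S'.i
  mO_homY : S.mO ≫ homY = S'.mO
  o_homY : S.o ≫ homY = homL ≫ S'.o

attribute [instance] Derivation.mono_mI Derivation.Hom.mono_homX

namespace Derivation

variable {C : Type u} [Category.{v} C] {p : Rule C} {S S' S'' : Derivation p}

/-- The composite of two embeddings of derivations. -/
def Hom.comp (φ : Hom S S') (ψ : Hom S' S'') : Hom S S'' where
  homX := φ.homX ≫ ψ.homX
  homL := φ.homL ≫ ψ.homL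
  homY := φ.homY ≫ ψ.homY
  mI_homX := by rw [reassoc_of% φ.mI_homX, ψ.mI_homX]
  i_homX := by rw [reassoc_of% φ.i_homX, ψ.i_homX, Category.assoc]
  mO_homY := by rw [reassoc_of% φ.mO_homY, ψ.mO_homY]
  o_homY := by rw [reassoc_of% φ.o_homY, ψ.o_homY, Category.assoc]

section HasMonoFPCs

variable [HasMonoFPCs C]

instance mono_mK (S : Derivation p) : Mono S.mK := (HasMonoFPCs.mono_of_isFPC S.fpc).1

instance mono_i (S : Derivation p) : Mono S.i := (HasMonoFPCs.mono_of_isFPC S.fpc).2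

theorem Hom.mK_homL (φ : Hom S S') : S.mK ≫ φ.homL = S'.mK := by
  rw [← cancel_mono S'.i, Category.assoc, ← φ.i_homX, ← reassoc_of% S.fpc.isPullback.w, φ.mI_homX,
    S'.fpc.isPullback.w]

theorem Hom.isPushout_o (φ : Hom S S') : IsPushout S.o φ.homL φ.homY S'.o :=
  .of_top (by rw [φ.mO_homY, φ.mK_homL]; exact S'.po) φ.o_homY S.po

theorem Hom.homY_eq_of_homX_eq {φ ψ : Hom S S'} (h : φ.homX = ψ.homX) : φ.homY = ψ.homY := by
  have hL : φ.homL = ψ.homL := by rw [← cancel_mono S'.i, ← φ.i_homX, h, ψ.i_homX]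
  exact S.po.hom_ext (by rw [φ.mO_homY, ψ.mO_homY]) (by rw [φ.o_homY, ψ.o_homY, hL])

end HasMonoFPCs

section Adhesive

variable [Adhesive C]

instance mono_o (S : Derivation p) : Mono S.o := Adhesive.mono_of_isPushout_of_mono_left S.po

theorem Hom.homX_eq_of_homY_eq (hS : IsPushout p.i S.mK S.mI S.i) {φ ψ : Hom S S'}
    (h : φ.homY = ψ.homY) : φ.homX = ψ.homX := by
  have hL : φ.homL = ψ.homL := by rw [← cancel_mono S'.o, ← φ.o_homY, h, ψ.o_homY]
  exact hS.hom_ext (by rw [φ.mI_homX, ψ.mI_homX]) (by rw [φ.i_homX, ψ.i_homX, hL])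

end Adhesive

variable [Adhesive C] [HasMonoFPCs C]

/-- The derivation from the input of a rule to its output. -/
def refl (p : Rule C) : Derivation p where
  X := p.I
  L := p.K
  Y := p.O
  mI := 𝟙 _
  mK := 𝟙 _
  mO := 𝟙 _
  o := p.o
  i := p.i
  fpc := .of_isPushout (.of_vert_isIso ⟨by simp⟩)
  po := .of_vert_isIso ⟨by simp⟩

instance mono_mO (S : Derivation p) : Mono S.mO :=
  Adhesive.mono_of_isPushout_of_mono_right S.po

/-- A derivation by `p` at the occurrence `mI`. -/
noncomputable abbrev ofMono (p : Rule C) {X : C} (mI : p.I ⟶ X) [Mono mI] : Derivation p :=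
  have h := HasMonoFPCs.exists_isFPC p.i mI
  { X := X, L := _, Y := _, mI := mI, mK := _, mO := _, o := _, i := _
    fpc := h.choose_spec.choose_spec.choose_spec
    po := IsPushout.of_hasPushout p.o h.choose_spec.choose }

/-- The derivation obtained by gluing the span of `S` with `L'` along `w`. -/
def extend (S : Derivation p) {X' L' Y' : C} {w : S.L ⟶ L'} [Mono w] {u : S.X ⟶ X'} {i' : L' ⟶ X'}
    {v : S.Y ⟶ Y'} {o' : L' ⟶ Y'} (hX : IsPushout S.i w u i') (hY : IsPushout S.o w v o') :
    Derivation p :=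
  have : Mono u := Adhesive.mono_of_isPushout_of_mono_right hX
  have : Mono i' := Adhesive.mono_of_isPushout_of_mono_left hX
  { X := X', L := L', Y := Y', mI := S.mI ≫ u, mK := S.mK ≫ w, mO := S.mO ≫ v, o := o', i := i'
    fpc := S.fpc.paste_horiz (.of_isPushout hX)
    po := S.po.paste_vert hY }

namespace Hom

/-- The embedding of a rule into a derivation. -/
def ofRefl (S : Derivation p) : Hom (refl p) S where
  homX := S.mI
  homL := S.mK
  homY := S.mO
  mono_homX := S.mono_mI
  mI_homX := Category.id_comp _
  i_homX := S.fpc.isPullback.w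
  mO_homY := Category.id_comp _
  o_homY := S.po.w

/-- The embedding of a derivation into its extension along `w`. -/
def extend {X' L' Y' : C} {w : S.L ⟶ L'} [Mono w] {u : S.X ⟶ X'}
    {i' : L' ⟶ X'} {v : S.Y ⟶ Y'} {o' : L' ⟶ Y'} (hX : IsPushout S.i w u i')
    (hY : IsPushout S.o w v o') : Hom S (S.extend hX hY) where
  homX := u
  homL := w
  homY := v
  mono_homX := Adhesive.mono_of_isPushout_of_mono_right hX
  mI_homX := rfl
  i_homX := hX.w
  mO_homY := rfl
  o_homY := hY.w

section

variable (φ : Hom S S')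

theorem isFPC_i : IsFPC S.i φ.homX φ.homL S'.i :=
  S.fpc.of_comp (by rw [φ.mI_homX]; exact S'.fpc) φ.i_homX

theorem isPullback_i : IsPullback S.i φ.homL φ.homX S'.i := φ.isFPC_i.isPullback

instance mono_homL : Mono φ.homL := φ.isPullback_i.mono_snd_of_mono

instance mono_homY : Mono φ.homY := Adhesive.mono_of_isPushout_of_mono_right φ.isPushout_o

theorem isPullback_o : IsPullback S.o φ.homL φ.homY S'.o :=
  Adhesive.isPullback_of_isPushout_of_mono_left φ.isPushout_o

end

theorem exists_of_homX (f : S.X ⟶ S'.X) [Mono f] (hf : S.mI ≫ f = S'.mI) :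
    ∃ φ : Hom S S', φ.homX = f := by
  obtain ⟨t, hK, ht⟩ := S.fpc.exists_of_comp (by rw [hf]; exact S'.fpc)
  obtain ⟨g, hO, ho⟩ := S.po.exists_desc S'.mO (t ≫ S'.o) (by rw [S'.po.w, reassoc_of% hK])
  exact ⟨⟨f, t, g, hf, ht.isPullback.w, hO, ho⟩, rfl⟩

theorem exists_of_homY {S₀ : Derivation p} (e : Hom S₀ S)
    (he : IsPushout S₀.i e.homL e.homX S.i) (e' : Hom S₀ S') (f : S.Y ⟶ S'.Y) [Mono f]
    (hf : e.homY ≫ f = e'.homY) : ∃ φ : Hom S S', φ.homY = f ∧ e.homX ≫ φ.homX = e'.homX := by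
  obtain ⟨t, ht, htf⟩ := (IsFPC.of_isPushout e.isPushout_o).exists_of_comp
    (by rw [hf]; exact .of_isPushout e'.isPushout_o)
  have : Mono t := htf.isPullback.mono_snd_of_mono
  have hX : IsPullback S₀.i e.homL e'.homX (t ≫ S'.i) := by
    simpa using (isPullback_of_fac ht).flip.paste_horiz e'.isPullback_i
  obtain ⟨g, _, hg, hg'⟩ := exists_mono_desc he hX
  exact ⟨⟨g, t, f, by rw [← e.mI_homX, Category.assoc, hg, e'.mI_homX], hg',
    by rw [← e.mO_homY, Category.assoc, hf, e'.mO_homY], htf.isPullback.w⟩, rfl, hg⟩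

end Hom

end Derivation

namespace CompDiagram

variable {C : Type u} [Category.{v} C] [Adhesive C] {p₂ p₁ : Rule C} {m : Match p₂ p₁}
  (D : CompDiagram m)

instance mono_k₁ : Mono D.k₁ :=
  (Adhesive.isPullback_of_isPushout_of_mono_left D.poc).mono_snd_of_mono

instance mono_n₁s : Mono D.n₁s := Adhesive.mono_of_isPushout_of_mono_right D.poI

/-- The derivation from `I₂₁` to `N` by `p₁`. -/
abbrev derivation₁ : Derivation p₁ where
  X := D.I₂₁
  L := D.K₁'
  Y := D.N
  mI := D.n₁s
  mK := D.k₁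
  mO := D.n₁
  o := D.o₁'
  i := D.i₁'
  fpc := .of_isPushout D.poI
  po := D.poc

/-- The derivation from `N` to `O₂₁` by `p₂`. -/
abbrev derivation₂ : Derivation p₂ where
  X := D.N
  L := D.K₂'
  Y := D.O₂₁
  mI := D.n₂
  mK := D.k₂
  mO := D.n₂s
  o := D.o₂'
  i := D.i₂'
  mono_mI := Adhesive.mono_of_isPushout_of_mono_right D.po
  fpc := D.fpc
  po := D.poO

end CompDiagram

namespace MatchClass

variable {C : Type u} [Category.{v} C] {p q : Rule C} {X : C}

/-- The match `m` is the intersection of the subobjects `a` and `b`. -/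
def IsOverlap (m : MatchClass p q) (a : p.I ⟶ X) (b : q.O ⟶ X) : Prop :=
  IsPullback m.out.m₂ m.out.m₁ a b

theorem IsOverlap.unique {m m' : MatchClass p q} {a : p.I ⟶ X} {b : q.O ⟶ X}
    (h : m.IsOverlap a b) (h' : m'.IsOverlap a b) : m = m' :=
  Quotient.out_equiv_out.1 ⟨h.isoIsPullback _ _ h', h.isoIsPullback_hom_fst _ _ h',
    h.isoIsPullback_hom_snd _ _ h'⟩

variable [Adhesive C]

theorem exists_isOverlap {L : C} {k : q.K ⟶ L} {l : L ⟶ X} (a : p.I ⟶ X) {b : q.O ⟶ X} [Mono a]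
    [Mono b] (h : IsPushout q.o k b l) : ∃ m : MatchClass p q, m.IsOverlap a b := by
  have hp := IsPullback.of_hasPullback a b
  have hN := IsPushout.of_hasPushout (pullback.fst a b) (pullback.snd a b)
  obtain ⟨u, _, -, hb⟩ := exists_mono_desc hN hp
  rw [← hb] at h
  have := Adhesive.mono_of_isPushout_of_mono_left hN
  obtain ⟨L', k', l', h'⟩ := exists_isPushout_of_comp_mono h
  let m : Match p q := ⟨_, _, _, _, _, _, _, _, _, hN, h'⟩
  obtain ⟨e, h₂, h₁⟩ : (⟦m⟧ : MatchClass p q).out ≈ m := Quotient.mk_out m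
  exact ⟨⟦m⟧, hp.of_iso e.symm (Iso.refl _) (Iso.refl _) (Iso.refl _) (by simp [← h₂, m])
    (by simp [← h₁, m]) (by simp) (by simp)⟩

variable [HasMonoFPCs C]

/-- The diagram that computes the composite along a chosen representative of `m`. -/
noncomputable def diagram (m : MatchClass p q) : CompDiagram m.out :=
  m.out.nonempty_compDiagram.some

theorem compClass_eq_comp {m : MatchClass p q} (D : CompDiagram m.out) :
    compClass m = ⟦D.comp⟧ := by
  conv_lhs => rw [← m.out_eq]
  exact Quotient.sound (CompDiagram.nonempty_ruleIso _ _ (RuleIso.refl _) (RuleIso.refl _)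
    (Iso.refl _) (by simp [RuleIso.refl]) (by simp [RuleIso.refl]))

end MatchClass

/-! ### Triple compositions -/

/-- The data that a composite of three rules glues together: a derivation by the middle rule `p₂`,
an occurrence `o₁` of the output of `p₁` in the object it starts from, an occurrence `i₃` of the
input of `p₃` in its result, and the complements that allow `p₁` to be undone and `p₃` to be
applied. The last two fields say that the span of the derivation is no larger than the three rules
require. -/
structure Triple {C : Type u} [Category.{v} C] (p₃ p₂ p₁ : Rule C) where
  step : Derivation p₂
  (J G : C)
  o₁ : p₁.O ⟶ step.X
  k₁ : p₁.K ⟶ J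
  j : J ⟶ step.X
  i₃ : p₃.I ⟶ step.Y
  k₃ : p₃.K ⟶ G
  g : G ⟶ step.Y
  [mono_o₁ : Mono o₁]
  [mono_i₃ : Mono i₃]
  poc : IsPushout p₁.o k₁ o₁ j
  fpc : IsFPC p₃.i i₃ k₃ g
  sup_mem_X : generateSingleton step.mI ⊔ generateSingleton o₁ ⊔ generateSingleton step.i ∈
    monoTopology C step.X
  sup_mem_L : generateSingleton step.mK ⊔ (generateSingleton o₁).pullback step.i ⊔
    (generateSingleton i₃).pullback step.o ∈ monoTopology C step.L

attribute [instance] Triple.mono_o₁ Triple.mono_i₃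

/-- An embedding of triple compositions of the same rules. -/
structure Triple.Hom {C : Type u} [Category.{v} C] {p₃ p₂ p₁ : Rule C} (T T' : Triple p₃ p₂ p₁)
    extends T.step.Hom T'.step where
  o₁_homX : T.o₁ ≫ homX = T'.o₁
  i₃_homY : T.i₃ ≫ homY = T'.i₃

section Covers

variable {C : Type u} [Category.{v} C] [Adhesive C] {p : Rule C} {S S' : Derivation p}
  (e : S.Hom S')

theorem Derivation.Hom.sup_mem_X_of_isPushout {A : C} {a : A ⟶ S'.X}
    (hX : generateSingleton e.homX ⊔ generateSingleton a ∈ monoTopology C S'.X)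
    (hS : IsPushout p.i S.mK S.mI S.i) :
    generateSingleton S'.mI ⊔ generateSingleton a ⊔ generateSingleton S'.i ∈
      monoTopology C S'.X := by
  rw [sup_comm] at hX
  refine mem_monoTopology_of_sup_mem hX (le_sup_right.trans le_sup_left)
    ((monoTopology C).superset_covering (sup_le ?_ ?_) (sup_mem_monoTopology_of_isPushout hS))
  · exact generateSingleton_le_iff.2 (Or.inl (Or.inl ⟨𝟙 _, by rw [Category.id_comp, e.mI_homX]⟩))
  · exact generateSingleton_le_iff.2 (Or.inr ⟨e.homL, e.i_homX.symm⟩)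

variable [HasMonoFPCs C]

theorem Derivation.Hom.sup_mem_L_of_sup_mem_X {A B : C} {a : A ⟶ S.X} {b : B ⟶ S'.Y}
    (hX : generateSingleton S.mI ⊔ generateSingleton a ∈ monoTopology C S.X)
    (hY : generateSingleton b ⊔ generateSingleton e.homY ∈ monoTopology C S'.Y) :
    generateSingleton S'.mK ⊔ (generateSingleton (a ≫ e.homX)).pullback S'.i ⊔
      (generateSingleton b).pullback S'.o ∈ monoTopology C S'.L := by
  have h : (generateSingleton b).pullback S'.o ⊔ generateSingleton e.homL ∈
      monoTopology C S'.L := by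
    rw [generateSingleton_eq_pullback e.isPullback_o.flip]
    exact (monoTopology C).pullback_stable S'.o hY
  refine mem_monoTopology_of_sup_mem h le_sup_right
    ((monoTopology C).superset_covering ?_ ((monoTopology C).pullback_stable S.i hX))
  rintro Z z (hz | ⟨t, ht⟩)
  · obtain ⟨t, rfl⟩ := (generateSingleton_eq_pullback S.fpc.isPullback.flip).ge _ hz
    exact Or.inl (Or.inl ⟨t, by rw [Category.assoc, e.mK_homL]⟩)
  · exact Or.inl (Or.inr ⟨t, by rw [reassoc_of% ht, Category.assoc, e.i_homX]⟩)

theorem Derivation.Hom.sup_mem_L_of_sup_mem_Y {A B : C} {a : A ⟶ S'.X} {b : B ⟶ S.Y}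
    (hX : generateSingleton e.homX ⊔ generateSingleton a ∈ monoTopology C S'.X)
    (hY : generateSingleton b ⊔ generateSingleton S.mO ∈ monoTopology C S.Y) :
    generateSingleton S'.mK ⊔ (generateSingleton a).pullback S'.i ⊔
      (generateSingleton (b ≫ e.homY)).pullback S'.o ∈ monoTopology C S'.L := by
  have h : (generateSingleton a).pullback S'.i ⊔ generateSingleton e.homL ∈
      monoTopology C S'.L := by
    rw [generateSingleton_eq_pullback e.isPullback_i.flip]
    rw [sup_comm] at hX
    exact (monoTopology C).pullback_stable S'.i hX
  refine mem_monoTopology_of_sup_mem h (le_sup_right.trans le_sup_left)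
    ((monoTopology C).superset_covering ?_ ((monoTopology C).pullback_stable S.o hY))
  have hK := Adhesive.isPullback_of_isPushout_of_mono_left S.po
  rintro Z z (⟨t, ht⟩ | hz)
  · exact Or.inr ⟨t, by rw [reassoc_of% ht, Category.assoc, e.o_homY]⟩
  · obtain ⟨t, rfl⟩ := (generateSingleton_eq_pullback hK.flip).ge _ hz
    exact Or.inl (Or.inl ⟨t, by rw [Category.assoc, e.mK_homL]⟩)

theorem Derivation.Hom.sup_mem_X_of_sup_mem {A : C} {a : A ⟶ S.X}
    (hX : generateSingleton S.mI ⊔ generateSingleton a ∈ monoTopology C S.X)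
    (he : IsPushout S.i e.homL e.homX S'.i) :
    generateSingleton S'.mI ⊔ generateSingleton (a ≫ e.homX) ⊔ generateSingleton S'.i ∈
      monoTopology C S'.X := by
  refine mem_monoTopology_of_sup_mem (sup_mem_monoTopology_of_isPushout he.flip) le_sup_right
    ((monoTopology C).superset_covering (sup_le ?_ ?_) hX)
  · exact generateSingleton_le_iff.2 (Or.inl (Or.inl ⟨𝟙 _, by rw [Category.id_comp, e.mI_homX]⟩))
  · exact generateSingleton_le_iff.2 (Or.inl (Or.inr ⟨𝟙 _, Category.id_comp _⟩))

end Covers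

namespace Triple

variable {C : Type u} [Category.{v} C] [Adhesive C] {p₃ p₂ p₁ : Rule C} (T : Triple p₃ p₂ p₁)

instance mono_j : Mono T.j := Adhesive.mono_of_isPushout_of_mono_left T.poc

variable [HasMonoFPCs C]

instance mono_g : Mono T.g := (HasMonoFPCs.mono_of_isFPC T.fpc).2

/-- The composite of three rules along a triple composition: the span of the middle derivation is
restricted to `G` and `J`, and the remaining parts of `p₃` and `p₁` are glued on. -/
noncomputable def comp : Rule C where
  O := pushout p₃.o T.k₃
  K := pullback (pullback.snd T.g T.step.o) (pullback.fst T.step.i T.j)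
  I := pushout p₁.i T.k₁
  o := pullback.fst _ _ ≫ pullback.fst _ _ ≫ pushout.inr _ _
  i := pullback.snd _ _ ≫ pullback.snd _ _ ≫ pushout.inr _ _
  mono_o :=
    have : Mono (pushout.inr p₃.o T.k₃) :=
      Adhesive.mono_of_isPushout_of_mono_left (IsPushout.of_hasPushout _ _)
    mono_comp' inferInstance (mono_comp' inferInstance inferInstance)
  mono_i :=
    have : Mono (pushout.inr p₁.i T.k₁) :=
      Adhesive.mono_of_isPushout_of_mono_left (IsPushout.of_hasPushout _ _)
    mono_comp' inferInstance (mono_comp' inferInstance inferInstance)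

variable {T} {S : Derivation p₂} (e : S.Hom T.step)

theorem sup_mem_Y_of_le (h : generateSingleton T.o₁ ≤ generateSingleton e.homX) :
    generateSingleton T.i₃ ⊔ generateSingleton e.homY ∈ monoTopology C T.step.Y := by
  have hY := sup_mem_monoTopology_of_isPushout T.step.po
  refine mem_monoTopology_of_sup_mem hY
    (generateSingleton_le_iff.2 (Or.inr ⟨S.mO, e.mO_homY⟩))
    ((monoTopology C).superset_covering ?_ T.sup_mem_L)
  rintro Z z ((⟨t, rfl⟩ | hz) | hz)
  · exact Or.inr ⟨t ≫ p₂.o ≫ S.mO, by simp [e.mO_homY, T.step.po.w]⟩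
  · obtain ⟨t, rfl⟩ := (generateSingleton_eq_pullback e.isPullback_i.flip).ge _ (h _ hz)
    exact Or.inr ⟨t ≫ S.o, by rw [Category.assoc, Category.assoc, e.o_homY]⟩
  · exact Or.inl hz

theorem sup_mem_X_of_le (h : generateSingleton T.i₃ ≤ generateSingleton e.homY) :
    generateSingleton e.homX ⊔ generateSingleton T.o₁ ∈ monoTopology C T.step.X := by
  refine mem_monoTopology_of_sup_mem T.sup_mem_X
    (sup_le (generateSingleton_le_iff.2 (Or.inl ⟨S.mI, e.mI_homX⟩)) le_sup_right)
    ((monoTopology C).superset_covering ?_ T.sup_mem_L)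
  rintro Z z ((⟨t, rfl⟩ | hz) | hz)
  · exact Or.inl ⟨t ≫ p₂.i ≫ S.mI, by simp [e.mI_homX, T.step.fpc.isPullback.w]⟩
  · exact Or.inr hz
  · obtain ⟨t, rfl⟩ := (generateSingleton_eq_pullback e.isPullback_o.flip).ge _ (h _ hz)
    exact Or.inl ⟨t ≫ S.i, by rw [Category.assoc, Category.assoc, e.i_homX]⟩

end Triple

/-- An embedding of the first step of the nested composition `p₃ (p₂ p₁)` into a triple
composition. -/
structure LeftEmb {C : Type u} [Category.{v} C] [Adhesive C] {p₃ p₂ p₁ : Rule C}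
    {m : Match p₂ p₁} (D : CompDiagram m) (T : Triple p₃ p₂ p₁) extends
    D.derivation₂.Hom T.step where
  n₁_homX : D.n₁ ≫ homX = T.o₁

namespace LeftEmb

variable {C : Type u} [Category.{v} C] [Adhesive C] {p₃ p₂ p₁ : Rule C} {m : Match p₂ p₁}
  {D : CompDiagram m} {T : Triple p₃ p₂ p₁}

theorem generateSingleton_o₁_le (e : LeftEmb D T) :
    generateSingleton T.o₁ ≤ generateSingleton e.homX :=
  generateSingleton_le_iff.2 ⟨D.n₁, e.n₁_homX⟩

theorem isOverlap {n : MatchClass p₂ p₁} {D : CompDiagram n.out} (e : LeftEmb D T) :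
    n.IsOverlap T.step.mI T.o₁ := by
  rw [← e.mI_homX, ← e.n₁_homX]
  exact isPullback_comp_mono (Adhesive.isPullback_of_isPushout_of_mono_left D.po) e.homX

variable [HasMonoFPCs C]

theorem isPushout_homX (e : LeftEmb D T) : IsPushout D.i₂' e.homL e.homX T.step.i := by
  refine isPushout_of_isPullback e.isPullback_i
    ((monoTopology C).superset_covering ?_ T.sup_mem_X)
  refine sup_le (sup_le ?_ ?_) le_sup_right
  · exact generateSingleton_le_iff.2 (Or.inl ⟨D.n₂, e.mI_homX⟩)
  · exact e.generateSingleton_o₁_le.trans le_sup_left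

theorem exists_isPushout_comp (e : LeftEmb D T) {J : C} {x : J ⟶ T.step.L} {y : J ⟶ T.J}
    (h : IsPullback x y T.step.i T.j) : ∃ (k : D.K₂₁ ⟶ J) (t : D.K₁' ⟶ T.J),
      D.k₁ ≫ t = T.k₁ ∧ IsPushout D.i₂'' k e.homL x ∧ IsPushout D.o₁'' k t y := by
  obtain ⟨t, ht, hfpc⟩ := (IsFPC.of_isPushout D.poc).exists_of_comp
    (by rw [e.n₁_homX]; exact .of_isPushout T.poc)
  have : Mono t := hfpc.isPullback.mono_snd_of_mono
  have : Mono x := h.mono_fst_of_mono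
  have : Mono y := h.mono_snd_of_mono
  obtain ⟨k, hL, hJ⟩ := exists_isPullback_of_isPullback D.pb h e.isPullback_i hfpc.isPullback
  have hj : generateSingleton e.homX ⊔ generateSingleton T.j ∈ monoTopology C T.step.X :=
    (monoTopology C).superset_covering
      (sup_le_sup_right e.generateSingleton_o₁_le _)
      (sup_mem_monoTopology_of_isPushout T.poc)
  have hi := sup_mem_monoTopology_of_isPushout e.isPushout_homX
  exact ⟨k, t, ht,
    isPushout_of_isPullback hL (sup_mem_monoTopology_of_isPullback e.isPullback_i.flip h hj),
    isPushout_of_isPullback hJ (sup_mem_monoTopology_of_isPullback hfpc.isPullback.flip h.flip hi)⟩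

theorem compClass_eq (e : LeftEmb D T) {n : MatchClass p₃ D.comp} (hn : n.IsOverlap T.i₃ e.homY) :
    compClass n = ⟦T.comp⟧ := by
  have hY := isPushout_of_isPullback (d := e.homY) hn
    (Triple.sup_mem_Y_of_le e.toHom e.generateSingleton_o₁_le)
  obtain ⟨k, t, ht, hL, hJ⟩ := e.exists_isPushout_comp (.of_hasPullback T.step.i T.j)
  obtain ⟨r, hr, hr'⟩ := D.poI.exists_desc (pushout.inl p₁.i T.k₁) (t ≫ pushout.inr p₁.i T.k₁)
    (by rw [pushout.condition, reassoc_of% ht])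
  have hI : IsPushout D.i₁' t r (pushout.inr p₁.i T.k₁) :=
    .of_top (by rw [ht, hr]; exact .of_hasPushout _ _) hr' D.poI
  let F : CompDiagram n.out := ⟨_, _, _, _, _, _, _, _, _, _, _, _, _, _, _, _, _, _, hY,
    hL.paste_horiz e.isPushout_o, hJ.paste_horiz hI, T.fpc, .of_hasPushout p₃.o T.k₃,
    (IsPullback.of_hasPullback (pullback.snd T.g T.step.o) _).paste_horiz (.of_hasPullback _ _)⟩
  refine (MatchClass.compClass_eq_comp F).trans
    (Quotient.sound ⟨Iso.refl _, Iso.refl _, Iso.refl _, ?_, ?_⟩)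
  · simp [F, CompDiagram.comp, Triple.comp]
  · simp [F, CompDiagram.comp, Triple.comp]

end LeftEmb

/-- An embedding of the first step of the nested composition `(p₃ p₂) p₁` into a triple
composition. -/
structure RightEmb {C : Type u} [Category.{v} C] [Adhesive C] {p₃ p₂ p₁ : Rule C}
    {m : Match p₃ p₂} (E : CompDiagram m) (T : Triple p₃ p₂ p₁) extends
    E.derivation₁.Hom T.step where
  n₂_homY : E.n₂ ≫ homY = T.i₃

namespace RightEmb

variable {C : Type u} [Category.{v} C] [Adhesive C] {p₃ p₂ p₁ : Rule C} {m : Match p₃ p₂}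
  {E : CompDiagram m} {T : Triple p₃ p₂ p₁}

theorem generateSingleton_i₃_le (e : RightEmb E T) :
    generateSingleton T.i₃ ≤ generateSingleton e.homY :=
  generateSingleton_le_iff.2 ⟨E.n₂, e.n₂_homY⟩

variable [HasMonoFPCs C]

theorem exists_isFPC_comp (e : RightEmb E T) {G : C} {x : G ⟶ T.G} {y : G ⟶ T.step.L}
    (h : IsPullback x y T.g T.step.o) : ∃ (k : E.K₂₁ ⟶ G) (t : E.K₂' ⟶ T.G),
      E.k₂ ≫ t = T.k₃ ∧ IsPushout E.i₂'' k t x ∧ IsFPC E.comp.i e.homX k (y ≫ T.step.i) := by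
  obtain ⟨t, ht, hfpc⟩ := E.fpc.exists_of_comp (by rw [e.n₂_homY]; exact T.fpc)
  have : Mono t := hfpc.isPullback.mono_snd_of_mono
  have : Mono x := h.mono_fst_of_mono
  have : Mono y := h.mono_snd_of_mono
  obtain ⟨k, hG, hL⟩ := exists_isPullback_of_isPullback E.pb h hfpc.isPullback e.isPullback_o
  have : Mono k := hG.mono_snd_of_mono
  have ho := sup_mem_monoTopology_of_isPushout e.isPushout_o
  exact ⟨k, t, ht,
    isPushout_of_isPullback hG (sup_mem_monoTopology_of_isPullback hfpc.isPullback.flip h ho),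
    e.isFPC_i.paste_vert (hfpc.of_isPullback E.pb.flip e.isPullback_o.flip h.flip hL.w)⟩

theorem compClass_eq (e : RightEmb E T) {n : MatchClass E.comp p₁} (hn : n.IsOverlap e.homX T.o₁) :
    compClass n = ⟦T.comp⟧ := by
  have hX := isPushout_of_isPullback (c := e.homX) hn
    (Triple.sup_mem_X_of_le e.toHom e.generateSingleton_i₃_le)
  obtain ⟨k, t, ht, hG, hk⟩ := e.exists_isFPC_comp (.of_hasPullback T.g T.step.o)
  obtain ⟨r, hr, hr'⟩ := E.poO.exists_desc (pushout.inl p₃.o T.k₃) (t ≫ pushout.inr p₃.o T.k₃)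
    (by rw [pushout.condition, reassoc_of% ht])
  have hO : IsPushout E.o₂' t r (pushout.inr p₃.o T.k₃) :=
    .of_top (by rw [ht, hr]; exact .of_hasPushout _ _) hr' E.poO
  let F : CompDiagram n.out := ⟨_, _, _, _, _, _, _, _, _, _, _, _, _, _, _, _, _, _, hX, T.poc,
    .of_hasPushout p₁.i T.k₁, hk, hG.paste_horiz hO,
    (IsPullback.of_hasPullback _ (pullback.fst T.step.i T.j)).paste_vert (.of_hasPullback _ _)⟩
  refine (MatchClass.compClass_eq_comp F).trans
    (Quotient.sound ⟨Iso.refl _, Iso.refl _, Iso.refl _, ?_, ?_⟩)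
  · simp [F, CompDiagram.comp, Triple.comp]
  · simp [F, CompDiagram.comp, Triple.comp]

theorem isOverlap {n : MatchClass p₃ p₂} {E : CompDiagram n.out} (e : RightEmb E T) :
    n.IsOverlap T.i₃ T.step.mO := by
  rw [← e.mO_homY, ← e.n₂_homY]
  exact isPullback_comp_mono (Adhesive.isPullback_of_isPushout_of_mono_left E.po) e.homY

end RightEmb

namespace CompDiagram

variable {C : Type u} [Category.{v} C] [Adhesive C] [HasMonoFPCs C] {p₃ p₂ p₁ : Rule C}

theorem exists_leftEmb {m : Match p₂ p₁} (D : CompDiagram m) (n : MatchClass p₃ D.comp) :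
    ∃ (T : Triple p₃ p₂ p₁) (e : LeftEmb D T), n.IsOverlap T.i₃ e.homY := by
  obtain ⟨Y, i₃, v, K, k, l, hn, hk⟩ : ∃ (Y : C) (i₃ : p₃.I ⟶ Y) (v : D.O₂₁ ⟶ Y) (K : C)
    (k : D.K₂₁ ⟶ K) (l : K ⟶ Y), IsPushout n.out.m₂ n.out.m₁ i₃ v ∧
      IsPushout (D.i₂'' ≫ D.o₂') k v l := n.out.admissible
  have : Mono i₃ := Adhesive.mono_of_isPushout_of_mono_right hn
  have : Mono v := Adhesive.mono_of_isPushout_of_mono_left hn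
  have : Mono k := (Adhesive.isPullback_of_isPushout_of_mono_left hk).mono_snd_of_mono
  obtain ⟨L, w, r, o, hL, hY, -⟩ := exists_isPushout_of_isPushout_comp hk
  have : Mono w := Adhesive.mono_of_isPushout_of_mono_right hL
  obtain ⟨X, u, i, hX⟩ : ∃ (X : C) (u : D.N ⟶ X) (i : L ⟶ X), IsPushout D.i₂' w u i :=
    ⟨_, _, _, .of_hasPushout _ _⟩
  have : Mono u := Adhesive.mono_of_isPushout_of_mono_right hX
  have : Mono i := Adhesive.mono_of_isPushout_of_mono_left hX
  obtain ⟨J, t, -, j, -, hJ, -⟩ :=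
    exists_isPushout_of_isPushout_comp (by rw [← D.pb.w]; exact hL.paste_horiz hX)
  obtain ⟨G, k₃, g, hG⟩ := HasMonoFPCs.exists_isFPC p₃.i i₃
  have cover_N := sup_mem_monoTopology_of_isPushout D.po
  have cover_Y := sup_mem_monoTopology_of_isPushout hn
  let e := Derivation.Hom.extend (S := D.derivation₂) hX hY
  exact ⟨{
    step := D.derivation₂.extend hX hY
    J := J, G := G
    o₁ := D.n₁ ≫ u, k₁ := D.k₁ ≫ t, j := j, i₃ := i₃, k₃ := k₃, g := g
    mono_o₁ := mono_comp _ u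
    mono_i₃ := ‹_›
    poc := D.poc.paste_vert hJ
    fpc := hG
    sup_mem_X := e.sup_mem_X_of_sup_mem cover_N hX
    sup_mem_L := e.sup_mem_L_of_sup_mem_X cover_N cover_Y },
    ⟨e, rfl⟩, Adhesive.isPullback_of_isPushout_of_mono_left hn⟩

theorem exists_rightEmb {m : Match p₃ p₂} (E : CompDiagram m) (n : MatchClass E.comp p₁) :
    ∃ (T : Triple p₃ p₂ p₁) (e : RightEmb E T), n.IsOverlap e.homX T.o₁ := by
  obtain ⟨S, e, o₁, J, k₁, j, hn, hJ⟩ : ∃ (S : Derivation p₂) (e : E.derivation₁.Hom S)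
      (o₁ : p₁.O ⟶ S.X) (J : C) (k₁ : p₁.K ⟶ J) (j : J ⟶ S.X),
      IsPushout n.out.m₂ n.out.m₁ e.homX o₁ ∧ IsPushout p₁.o k₁ o₁ j := by
    obtain ⟨X, u, o₁, J, k₁, j, hn, hJ⟩ : ∃ (X : C) (u : E.I₂₁ ⟶ X) (o₁ : p₁.O ⟶ X) (J : C)
      (k₁ : p₁.K ⟶ J) (j : J ⟶ X), IsPushout n.out.m₂ n.out.m₁ u o₁ ∧
        IsPushout p₁.o k₁ o₁ j := n.out.admissible
    have : Mono u := Adhesive.mono_of_isPushout_of_mono_right hn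
    have : Mono (E.n₁s ≫ u) := mono_comp _ _
    obtain ⟨e, he⟩ := Derivation.Hom.exists_of_homX (S := E.derivation₁)
      (S' := .ofMono p₂ (E.n₁s ≫ u)) (f := u) (hf := rfl)
    exact ⟨_, e, o₁, J, k₁, j, by rw [he]; exact hn, hJ⟩
  obtain ⟨G, k₃, g, hG⟩ := HasMonoFPCs.exists_isFPC p₃.i (E.n₂ ≫ e.homY)
  have : Mono o₁ := Adhesive.mono_of_isPushout_of_mono_left hn
  have cover_X : generateSingleton e.homX ⊔ generateSingleton o₁ ∈ monoTopology C S.X :=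
    have : Mono (X := E.comp.I) e.homX := e.mono_homX
    sup_mem_monoTopology_of_isPushout (a := n.out.m₂) hn
  exact ⟨{
    step := S
    J := J, G := G
    o₁ := o₁, k₁ := k₁, j := j, i₃ := E.n₂ ≫ e.homY, k₃ := k₃, g := g
    mono_i₃ := mono_comp _ _
    poc := hJ
    fpc := hG
    sup_mem_X := e.sup_mem_X_of_isPushout cover_X E.poI
    sup_mem_L := e.sup_mem_L_of_sup_mem_Y cover_X (sup_mem_monoTopology_of_isPushout E.po) },
    ⟨e, rfl⟩, Adhesive.isPullback_of_isPushout_of_mono_left hn⟩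

end CompDiagram

section Pairs

variable {C : Type u} [Category.{v} C] {p q : Rule C} {X Y : C}

theorem MatchClass.IsOverlap.comp_mono {m : MatchClass p q} {a : p.I ⟶ X} {b : q.O ⟶ X}
    (h : m.IsOverlap a b) (u : X ⟶ Y) [Mono u] : m.IsOverlap (a ≫ u) (b ≫ u) :=
  isPullback_comp_mono h u

variable [Adhesive C] [HasMonoFPCs C] {p₃ p₂ p₁ : Rule C}

/-- The pairs of matches along which `p₃ (p₂ p₁)` is composed. -/
abbrev LeftPair (p₃ p₂ p₁ : Rule C) :=
  Σ m : MatchClass p₂ p₁, MatchClass p₃ m.diagram.comp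

/-- The pairs of matches along which `(p₃ p₂) p₁` is composed. -/
abbrev RightPair (p₃ p₂ p₁ : Rule C) :=
  Σ m : MatchClass p₃ p₂, MatchClass m.diagram.comp p₁

/-- The triple composition `T` glues the three rules along the matches of `x`. -/
def LeftPair.Realizes (x : LeftPair p₃ p₂ p₁) (T : Triple p₃ p₂ p₁) : Prop :=
  ∃ e : LeftEmb x.1.diagram T, x.2.IsOverlap T.i₃ e.homY

/-- The triple composition `T` glues the three rules along the matches of `y`. -/
def RightPair.Realizes (y : RightPair p₃ p₂ p₁) (T : Triple p₃ p₂ p₁) : Prop :=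
  ∃ e : RightEmb y.1.diagram T, y.2.IsOverlap e.homX T.o₁

namespace LeftPair

variable {x x' : LeftPair p₃ p₂ p₁} {T T' : Triple p₃ p₂ p₁}

theorem exists_realizes (T : Triple p₃ p₂ p₁) : ∃ x : LeftPair p₃ p₂ p₁, x.Realizes T := by
  obtain ⟨m, hm⟩ := MatchClass.exists_isOverlap T.step.mI T.poc
  obtain ⟨u, _, hu₂, hu₁⟩ := exists_mono_desc m.diagram.po hm
  obtain ⟨φ, rfl⟩ := Derivation.Hom.exists_of_homX (S := m.diagram.derivation₂) u hu₂
  let e : LeftEmb m.diagram T := ⟨φ, hu₁⟩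
  obtain ⟨k, t, -, hk, -⟩ := e.exists_isPushout_comp (.of_hasPullback T.step.i T.j)
  have : Mono (X := m.diagram.comp.O) e.homY := e.toHom.mono_homY
  obtain ⟨n, hn⟩ := MatchClass.exists_isOverlap (q := m.diagram.comp) T.i₃
    (hk.paste_horiz e.isPushout_o)
  exact ⟨⟨m, n⟩, e, hn⟩

theorem Realizes.nonempty_hom (h : x.Realizes T) (h' : x.Realizes T') : Nonempty (T.Hom T') := by
  obtain ⟨e, hn⟩ := h
  obtain ⟨e', hn'⟩ := h'
  have hY := isPushout_of_isPullback (d := e.homY) hn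
    (Triple.sup_mem_Y_of_le e.toHom e.generateSingleton_o₁_le)
  obtain ⟨f, _, hf₃, hf⟩ := exists_mono_desc (d' := e'.homY) hY hn'
  obtain ⟨φ, rfl, hφ⟩ := Derivation.Hom.exists_of_homY e.toHom e.isPushout_homX e'.toHom f hf
  exact ⟨φ, by rw [← e.n₁_homX, Category.assoc, hφ, e'.n₁_homX], hf₃⟩

theorem Realizes.comp (h : x.Realizes T) (φ : T.Hom T') : x.Realizes T' := by
  obtain ⟨e, hn⟩ := h
  have hn' := hn.comp_mono φ.homY
  rw [φ.i₃_homY] at hn'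
  exact ⟨⟨e.toHom.comp φ.toHom, by
    rw [← φ.o₁_homX, ← e.n₁_homX, Category.assoc, Derivation.Hom.comp]⟩, hn'⟩

theorem Realizes.unique (h : x.Realizes T) (h' : x'.Realizes T) : x = x' := by
  obtain ⟨m, n⟩ := x
  obtain ⟨m', n'⟩ := x'
  obtain ⟨e, hn⟩ := h
  obtain ⟨e', hn'⟩ := h'
  obtain rfl : m = m' := e.isOverlap.unique e'.isOverlap
  have hX : e.homX = e'.homX := m.diagram.po.hom_ext (by rw [e.mI_homX, e'.mI_homX])
    (by rw [e.n₁_homX, e'.n₁_homX])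
  have hY : e.homY = e'.homY := Derivation.Hom.homY_eq_of_homX_eq hX
  rw [hY] at hn
  exact congrArg (Sigma.mk m) (hn.unique hn')

theorem Realizes.compClass_eq (h : x.Realizes T) : compClass x.2 = ⟦T.comp⟧ :=
  h.elim fun e hn => e.compClass_eq hn

end LeftPair

namespace RightPair

variable {y y' : RightPair p₃ p₂ p₁} {T T' : Triple p₃ p₂ p₁}

theorem exists_realizes (T : Triple p₃ p₂ p₁) : ∃ y : RightPair p₃ p₂ p₁, y.Realizes T := by
  obtain ⟨m, hm⟩ := MatchClass.exists_isOverlap T.i₃ T.step.po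
  obtain ⟨f, _, hf₂, hf₁⟩ := exists_mono_desc m.diagram.po hm
  obtain ⟨φ, rfl, -⟩ := Derivation.Hom.exists_of_homY (.ofRefl m.diagram.derivation₁)
    m.diagram.poI (.ofRefl T.step) f hf₁
  let e : RightEmb m.diagram T := ⟨φ, hf₂⟩
  have : Mono (X := m.diagram.comp.I) e.homX := e.mono_homX
  obtain ⟨n, hn⟩ := MatchClass.exists_isOverlap (p := m.diagram.comp) e.homX T.poc
  exact ⟨⟨m, n⟩, e, hn⟩

theorem Realizes.nonempty_hom (h : y.Realizes T) (h' : y.Realizes T') : Nonempty (T.Hom T') := by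
  obtain ⟨e, hn⟩ := h
  obtain ⟨e', hn'⟩ := h'
  have hX := isPushout_of_isPullback (c := e.homX) hn
    (Triple.sup_mem_X_of_le e.toHom e.generateSingleton_i₃_le)
  obtain ⟨f, _, hf, hf₁⟩ := exists_mono_desc (c' := e'.homX) hX hn'
  obtain ⟨φ, rfl⟩ := Derivation.Hom.exists_of_homX (S := T.step) (S' := T'.step) f
    (by rw [← e.mI_homX, Category.assoc, hf, e'.mI_homX])
  have hY : e.homY ≫ φ.homY = e'.homY :=
    Derivation.Hom.homY_eq_of_homX_eq (φ := e.toHom.comp φ) (ψ := e'.toHom) hf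
  exact ⟨φ, hf₁, by rw [← e.n₂_homY, Category.assoc, hY, e'.n₂_homY]⟩

theorem Realizes.comp (h : y.Realizes T) (φ : T.Hom T') : y.Realizes T' := by
  obtain ⟨e, hn⟩ := h
  have hn' := hn.comp_mono φ.homX
  rw [φ.o₁_homX] at hn'
  exact ⟨⟨e.toHom.comp φ.toHom, by
    rw [← φ.i₃_homY, ← e.n₂_homY, Category.assoc, Derivation.Hom.comp]⟩, hn'⟩

theorem Realizes.unique (h : y.Realizes T) (h' : y'.Realizes T) : y = y' := by
  obtain ⟨m, n⟩ := y
  obtain ⟨m', n'⟩ := y'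
  obtain ⟨e, hn⟩ := h
  obtain ⟨e', hn'⟩ := h'
  obtain rfl : m = m' := e.isOverlap.unique e'.isOverlap
  have hY : e.homY = e'.homY := m.diagram.po.hom_ext (by rw [e.n₂_homY, e'.n₂_homY])
    (by rw [e.mO_homY, e'.mO_homY])
  have hX : e.homX = e'.homX := Derivation.Hom.homX_eq_of_homY_eq m.diagram.poI hY
  rw [hX] at hn
  exact congrArg (Sigma.mk m) (hn.unique hn')

theorem Realizes.compClass_eq (h : y.Realizes T) : compClass y.2 = ⟦T.comp⟧ :=
  h.elim fun e hn => e.compClass_eq hn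

end RightPair

theorem exists_leftPair_equiv_rightPair (p₃ p₂ p₁ : Rule C) :
    ∃ f : LeftPair p₃ p₂ p₁ ≃ RightPair p₃ p₂ p₁, ∀ x, compClass (f x).2 = compClass x.2 := by
  have exists_triple (x : LeftPair p₃ p₂ p₁) : ∃ T, x.Realizes T := x.1.diagram.exists_leftEmb x.2
  choose T hT using exists_triple
  choose f hf using fun x => RightPair.exists_realizes (T x)
  have inj : Function.Injective f := fun x x' h => by
    obtain ⟨φ⟩ := (hf x).nonempty_hom (h ▸ hf x')
    exact ((hT x).comp φ).unique (hT x')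
  have surj : Function.Surjective f := fun y => by
    obtain ⟨T', hT'⟩ : ∃ T', y.Realizes T' := y.1.diagram.exists_rightEmb y.2
    obtain ⟨x, hx⟩ := LeftPair.exists_realizes T'
    obtain ⟨φ⟩ := (hT x).nonempty_hom hx
    exact ⟨x, ((hf x).comp φ).unique hT'⟩
  exact ⟨.ofBijective f ⟨inj, surj⟩, fun x => (hf x).compClass_eq.trans (hT x).compClass_eq.symm⟩

end Pairs

/-! ### The rule algebra -/

section Algebra

variable {C : Type u} [Category.{v} C]

theorem finite_matchClass (p₂ p₁ : Rule C) [Finite (Subobject p₂.I)]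
    [∀ Y : C, Finite {f : Y ⟶ p₁.O // Mono f}] : Finite (MatchClass p₂ p₁) := by
  let span (m : MatchClass p₂ p₁) : Σ S : Subobject p₂.I, {f : (S : C) ⟶ p₁.O // Mono f} :=
    ⟨.mk m.out.m₂, (Subobject.underlyingIso m.out.m₂).hom ≫ m.out.m₁, inferInstance⟩
  have exists_iso (m) : ∃ e : m.out.M ≅ ((span m).1 : C),
      m.out.m₂ = e.hom ≫ (span m).1.arrow ∧ m.out.m₁ = e.hom ≫ (span m).2.1 :=
    ⟨(Subobject.underlyingIso m.out.m₂).symm, by simp [span], by simp [span]⟩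
  refine Finite.of_injective span fun m m' h => Quotient.out_equiv_out.1 ?_
  obtain ⟨e, h₂, h₁⟩ := exists_iso m
  obtain ⟨e', h₂', h₁'⟩ := h ▸ exists_iso m'
  exact ⟨e ≪≫ e'.symm, by simp [h₂, h₂'], by simp [h₁, h₁']⟩

theorem induction_δ {P : RuleAlgebra C → Prop} (R : RuleAlgebra C) (zero : P 0)
    (add : ∀ R S, P R → P S → P (R + S)) (smul : ∀ (x : ℝ) (a : Lin C), P (x • δ a)) : P R :=
  R.induction_linear zero add fun a x => by simpa [δ] using smul x a

variable [Adhesive C] [HasMonoFPCs C]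

theorem mul_δ_δ (a b : Lin C) : mul C (δ a) (δ b) = basisMul a b := by
  simp [mul, δ]

theorem basisMul_mk (p₂ p₁ : Rule C) [Fintype (MatchClass p₂ p₁)] :
    basisMul (⟦p₂⟧ : Lin C) ⟦p₁⟧ = ∑ m : MatchClass p₂ p₁, δ (compClass m) :=
  finsum_eq_sum_of_fintype _

theorem mul_basisMul_assoc (hM : ∀ p₂ p₁ : Rule C, Finite (MatchClass p₂ p₁)) (a₃ a₂ a₁ : Lin C) :
    mul C (basisMul a₃ a₂) (δ a₁) = mul C (δ a₃) (basisMul a₂ a₁) := by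
  obtain ⟨p₃, rfl⟩ := Quotient.exists_rep a₃
  obtain ⟨p₂, rfl⟩ := Quotient.exists_rep a₂
  obtain ⟨p₁, rfl⟩ := Quotient.exists_rep a₁
  have := fun p₂ p₁ : Rule C => Fintype.ofFinite (MatchClass p₂ p₁)
  obtain ⟨f, hf⟩ := exists_leftPair_equiv_rightPair p₃ p₂ p₁
  calc mul C (basisMul ⟦p₃⟧ ⟦p₂⟧) (δ ⟦p₁⟧)
      = ∑ y : RightPair p₃ p₂ p₁, δ (compClass y.2) := by
        simp only [basisMul_mk, map_sum, LinearMap.sum_apply, Fintype.sum_sigma, mul_δ_δ,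
          MatchClass.compClass_eq_comp (MatchClass.diagram _)]
    _ = ∑ x : LeftPair p₃ p₂ p₁, δ (compClass x.2) :=
        (Fintype.sum_equiv f _ _ fun x => by rw [hf]).symm
    _ = mul C (δ ⟦p₃⟧) (basisMul ⟦p₂⟧ ⟦p₁⟧) := by
        simp only [basisMul_mk, map_sum, Fintype.sum_sigma, mul_δ_δ,
          MatchClass.compClass_eq_comp (MatchClass.diagram _)]

protected theorem mul_assoc (hM : ∀ p₂ p₁ : Rule C, Finite (MatchClass p₂ p₁))
    (R₃ R₂ R₁ : RuleAlgebra C) : mul C (mul C R₃ R₂) R₁ = mul C R₃ (mul C R₂ R₁) := by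
  induction R₃ using induction_δ with
  | zero => simp
  | add f g hf hg => simp only [map_add, LinearMap.add_apply, hf, hg]
  | smul x a =>
  induction R₂ using induction_δ with
  | zero => simp
  | add f g hf hg => simp only [map_add, LinearMap.add_apply, hf, hg]
  | smul y b =>
  induction R₁ using induction_δ with
  | zero => simp
  | add f g hf hg => simp only [map_add, hf, hg]
  | smul z c => simp only [map_smul, LinearMap.smul_apply, mul_δ_δ, mul_basisMul_assoc hM]

section Unit

theorem basisMul_eq_δ {q p r : Rule C} (m : Match q p) (hm : ∀ m' : Match q p, m' ≈ m)
    (D : CompDiagram m) (e : RuleIso D.comp r) : basisMul (⟦q⟧ : Lin C) ⟦p⟧ = δ ⟦r⟧ := by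
  let : Unique (MatchClass q p) := ⟨⟨⟦m⟧⟩, by rintro ⟨m'⟩; exact Quotient.sound (hm m')⟩
  obtain ⟨f⟩ := m.nonempty_compDiagram.some.nonempty_ruleIso D (.refl q) (.refl p) (Iso.refl _)
    (by simp [RuleIso.refl]) (by simp [RuleIso.refl])
  exact (finsum_unique _).trans (congrArg δ (Quotient.sound ⟨f.trans e⟩))

variable [HasInitial C] [InitialMonoClass C]

theorem emptyRule_basisMul (p : Rule C) : basisMul (⟦emptyRule C⟧ : Lin C) ⟦p⟧ = δ ⟦p⟧ := by
  let m : Match (emptyRule C) p :=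
    { M := ⊥_ C
      m₂ := 𝟙 (⊥_ C)
      m₁ := initial.to p.O
      mono_m₂ := inferInstanceAs (Mono (𝟙 (⊥_ C)))
      mono_m₁ := inferInstance
      admissible := ⟨p.O, initial.to p.O, 𝟙 _, p.K, 𝟙 _, p.o, .of_id_fst, .of_id_snd⟩ }
  have unique_match (m' : Match (emptyRule C) p) : m' ≈ m := by
    have : Mono (Y := ⊥_ C) m'.m₂ := m'.mono_m₂
    have : IsSplitEpi (Y := ⊥_ C) m'.m₂ := initialIsInitial.isSplitEpi_to _
    have : IsIso (Y := ⊥_ C) m'.m₂ := isIso_of_mono_of_isSplitEpi _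
    let e : m'.M ≅ ⊥_ C := asIso (Y := ⊥_ C) m'.m₂
    exact ⟨e, Category.comp_id (Y := ⊥_ C) m'.m₂, (initialIsInitial.ofIso e.symm).hom_ext _ _⟩
  refine basisMul_eq_δ m unique_match ⟨p.O, p.O, p.K, p.O, p.I, p.K, initial.to p.O, 𝟙 _,
    initial.to p.O, 𝟙 _, initial.to p.O, 𝟙 _, 𝟙 _, p.o, 𝟙 _, p.i, p.o, 𝟙 _, .of_id_fst,
    .of_id_snd, .of_id_snd, .of_isPushout (a := 𝟙 (⊥_ C)) (c := initial.to p.O) .of_id_fst,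
    .of_id_fst, .of_id_snd⟩ ⟨Iso.refl _, Iso.refl _, Iso.refl _, ?_, ?_⟩
  · simp [CompDiagram.comp]
  · simp [CompDiagram.comp]

theorem basisMul_emptyRule (p : Rule C) : basisMul (⟦p⟧ : Lin C) ⟦emptyRule C⟧ = δ ⟦p⟧ := by
  let m : Match p (emptyRule C) :=
    { M := ⊥_ C
      m₂ := initial.to p.I
      m₁ := 𝟙 (⊥_ C)
      mono_m₂ := inferInstance
      mono_m₁ := inferInstanceAs (Mono (𝟙 (⊥_ C)))
      admissible := ⟨p.I, 𝟙 _, initial.to p.I, p.I, initial.to p.I, 𝟙 _, .of_id_snd,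
        .of_id_fst⟩ }
  have unique_match (m' : Match p (emptyRule C)) : m' ≈ m := by
    have : Mono (Y := ⊥_ C) m'.m₁ := m'.mono_m₁
    have : IsSplitEpi (Y := ⊥_ C) m'.m₁ := initialIsInitial.isSplitEpi_to _
    have : IsIso (Y := ⊥_ C) m'.m₁ := isIso_of_mono_of_isSplitEpi _
    let e : m'.M ≅ ⊥_ C := asIso (Y := ⊥_ C) m'.m₁
    exact ⟨e, (initialIsInitial.ofIso e.symm).hom_ext _ _, Category.comp_id (Y := ⊥_ C) m'.m₁⟩
  refine basisMul_eq_δ m unique_match ⟨p.I, p.K, p.I, p.O, p.I, p.K, 𝟙 _, initial.to p.I,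
    𝟙 _, p.i, 𝟙 _, p.o, initial.to p.I, 𝟙 _, initial.to p.I, 𝟙 _, 𝟙 _, p.i, .of_id_snd,
    .of_id_fst, .of_id_fst, .of_isPushout .of_id_snd, .of_id_snd, .of_id_fst⟩
    ⟨Iso.refl _, Iso.refl _, Iso.refl _, ?_, ?_⟩
  · simp [CompDiagram.comp]
  · simp [CompDiagram.comp]

theorem emptyRule_mul (R : RuleAlgebra C) : mul C (δ ⟦emptyRule C⟧) R = R := by
  induction R using induction_δ with
  | zero => simp
  | add f g hf hg => simp only [map_add, hf, hg]
  | smul x a =>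
    obtain ⟨p, rfl⟩ := Quotient.exists_rep a
    rw [map_smul, mul_δ_δ, emptyRule_basisMul]

theorem mul_emptyRule (R : RuleAlgebra C) : mul C R (δ ⟦emptyRule C⟧) = R := by
  induction R using induction_δ with
  | zero => simp
  | add f g hf hg => simp only [map_add, LinearMap.add_apply, hf, hg]
  | smul x a =>
    obtain ⟨p, rfl⟩ := Quotient.exists_rep a
    rw [map_smul, LinearMap.smul_apply, mul_δ_δ, basisMul_emptyRule]

end Unit

end Algebra

end SqPO

theorem mainTheorem3_general {C : Type u} [Category.{v} C] [Adhesive C] [SqPO.HasMonoFPCs C]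
    [HasInitial C] [InitialMonoClass C] (hfin : ∀ X : C, Finite (Subobject X))
    (hmono : ∀ Y X : C, Finite {f : Y ⟶ X // Mono f}) :
    (∀ p₂ p₁ : SqPO.Rule C, Finite (SqPO.MatchClass p₂ p₁)) ∧
    (∀ R₃ R₂ R₁ : SqPO.RuleAlgebra C,
      SqPO.mul C (SqPO.mul C R₃ R₂) R₁ = SqPO.mul C R₃ (SqPO.mul C R₂ R₁)) ∧
    (∀ R : SqPO.RuleAlgebra C, SqPO.mul C (SqPO.δ ⟦SqPO.emptyRule C⟧) R = R) ∧
    (∀ R : SqPO.RuleAlgebra C, SqPO.mul C R (SqPO.δ ⟦SqPO.emptyRule C⟧) = R) :=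
  have finite_matches (p₂ p₁ : SqPO.Rule C) : Finite (SqPO.MatchClass p₂ p₁) :=
    have := hfin p₂.I
    have := fun Y => hmono Y p₁.O
    SqPO.finite_matchClass p₂ p₁
  ⟨finite_matches, SqPO.mul_assoc finite_matches, SqPO.emptyRule_mul, SqPO.mul_emptyRule⟩

theorem mainTheorem3 {C : Type u} [Category.{v} C] [HasPullbacks C] [Adhesive C]
    [SqPO.HasMonoFPCs C] [HasInitial C] [HasStrictInitialObjects C]
    (hfin : ∀ X : C, Finite (Subobject X))
    (hmono : ∀ Y X : C, Finite {f : Y ⟶ X // Mono f}) :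
    (∀ p₂ p₁ : SqPO.Rule C, Finite (SqPO.MatchClass p₂ p₁)) ∧
    (∀ R₃ R₂ R₁ : SqPO.RuleAlgebra C,
      SqPO.mul C (SqPO.mul C R₃ R₂) R₁ = SqPO.mul C R₃ (SqPO.mul C R₂ R₁)) ∧
    (∀ R : SqPO.RuleAlgebra C, SqPO.mul C (SqPO.δ ⟦SqPO.emptyRule C⟧) R = R) ∧
    (∀ R : SqPO.RuleAlgebra C, SqPO.mul C R (SqPO.δ ⟦SqPO.emptyRule C⟧) = R) :=
  mainTheorem3_general hfin hmono
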